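/- Let $\Delta_1=\{p\in[0,1]^{\mathbb N}: p_1\ge p_2\ge\cdots,\ \sum_i p_i=1\}$, with the $\sigma$-algebra induced by the product $\sigma$-algebra. For $u\in[0,1]$ and an index $i$, let $S_i^u p\in\Delta_1$ be the non-increasing sequence obtained from $p\in\Delta_1$ by splitting $p_i$ into the two parts $u p_i$ and $(1-u)p_i$; for $i\ne j$, let $M_{ij}p\in\Delta_1$ be the non-increasing sequence obtained by merging $p_i$ and $p_j$ into one part $p_i+p_j$. For $\beta_{\rm s},\beta_{\rm m}\in(0,1]$ the uniform $(\beta_{\rm s},\beta_{\rm m})$ split–merge chain is the Markov chain on $\Delta_1$ with transition kernel $$K_{\beta_{\rm s},\beta_{\rm m}}(p,\cdot)=\beta_{\rm s}\sum_i p_i^2\int_0^1\delta_{S_i^u p}(\cdot)\,du+\beta_{\rm m}\sum_{i\ne j}p_ip_j\,\delta_{M_{ij}p}(\cdot)+\Bigl(1-\beta_{\rm s}\sum_i p_i^2-\beta_{\rm m}\sum_{i\ne j}p_ip_j\Bigr)\delta_p(\cdot),$$ where $i\neq j$ ranges over ordered pairs. For $\theta>0$ let $T_1,T_2,\dots$ be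 independent Beta$(1,\theta)$ random variables and let $\mathrm{PD}_\theta$ (Poisson–Dirichlet$(\theta)$) be the law on $\Delta_1$ of the sequence $P_{k+1}=T_{k+1}(1-T_1)\cdots(1-T_k)$, $k\ge 0$, sorted into decreasing order. **Theorem.** Let $\beta_{\rm s},\beta_{\rm m}\in(0,1]$ and $\theta=\beta_{\rm s}/\beta_{\rm m}$. Then $\mathrm{PD}_\theta$ is a probability measure on $\Delta_1$ and it is invariant for the uniform $(\beta_{\rm s},\beta_{\rm m})$ split–merge chain, i.e. $\mathrm{PD}_\theta K_{\beta_{\rm s},\beta_{\rm m}}=\mathrm{PD}_\theta$. -/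

import Mathlib

open MeasureTheory ProbabilityTheory
open scoped ENNReal

noncomputable section

namespace SplitMerge

/-- `Δ₁`: the decreasing countable partitions of `[0,1]`, as a set of real sequences. It carries
the σ-algebra induced by the product σ-algebra of `ℕ → ℝ`. -/
def Delta1 : Set (ℕ → ℝ) :=
  {p | (∀ i, p i ∈ Set.Icc (0 : ℝ) 1) ∧ Antitone p ∧ HasSum p 1}

/-- The decreasing rearrangement of a sequence: its `n`-th term (counted from `0`) is the
`(n+1)`-th largest entry, that is, the largest value of the minimum of the entries over an index
set of size `n + 1`. -/
def decRearr (x : ℕ → ℝ) (n : ℕ) : ℝ :=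
  ⨆ s : {s : Finset ℕ // s.card = n + 1},
    s.1.inf' (Finset.card_pos.mp (s.2.symm ▸ Nat.succ_pos n)) x

/-- The unsorted sequence `u p_i, p_0, p_1, …, (1-u) p_i, …` in which the part `p_i` is replaced by
the two parts `u p_i` and `(1-u) p_i`. -/
def splitSeq (i : ℕ) (u : ℝ) (p : ℕ → ℝ) : ℕ → ℝ
  | 0 => u * p i
  | k + 1 => Function.update p i ((1 - u) * p i) k

/-- The unsorted sequence in which `p_i` is replaced by `p_i + p_j` and `p_j` by an empty part. -/
def mergeSeq (i j : ℕ) (p : ℕ → ℝ) : ℕ → ℝ :=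
  Function.update (Function.update p j 0) i (p i + p j)

section Facts

theorem le_one_of_hasSum {x : ℕ → ℝ} (h0 : ∀ i, 0 ≤ x i) (h1 : HasSum x 1) (i : ℕ) : x i ≤ 1 :=
  le_hasSum h1 i fun j _ => h0 j

theorem lt_decRearr_iff {x : ℕ → ℝ} (h1 : ∀ i, x i ≤ 1) (t : ℝ) (n : ℕ) :
    t < decRearr x n ↔ ((n + 1 : ℕ) : ℕ∞) ≤ {i | t < x i}.encard := by
  have hne : ∀ s : {s : Finset ℕ // s.card = n + 1}, s.1.Nonempty := fun s =>
    Finset.card_pos.mp (s.2.symm ▸ Nat.succ_pos n)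
  have hbdd : BddAbove (Set.range fun s : {s : Finset ℕ // s.card = n + 1} =>
      s.1.inf' (hne s) x) := by
    refine ⟨1, ?_⟩
    rintro _ ⟨s, rfl⟩
    obtain ⟨i, hi⟩ := hne s
    exact (Finset.inf'_le x hi).trans (h1 i)
  have : Nonempty {s : Finset ℕ // s.card = n + 1} := ⟨⟨Finset.range (n + 1), by simp⟩⟩
  unfold decRearr
  rw [lt_ciSup_iff hbdd]
  constructor
  · rintro ⟨s, hs⟩
    rw [Finset.lt_inf'_iff] at hs
    have : (s.1 : Set ℕ) ⊆ {i | t < x i} := fun i hi => hs i hi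
    calc ((n + 1 : ℕ) : ℕ∞) = (s.1 : Set ℕ).encard := by
          rw [Set.encard_coe_eq_coe_finsetCard, s.2]
      _ ≤ _ := Set.encard_le_encard this
  · intro h
    obtain ⟨r, hr, hrc⟩ := Set.exists_subset_encard_eq h
    have hfin : r.Finite := Set.finite_of_encard_eq_coe hrc
    refine ⟨⟨hfin.toFinset, ?_⟩, ?_⟩
    · have h2 := hfin.encard_eq_coe_toFinset_card
      rw [hrc] at h2
      exact_mod_cast h2.symm
    · rw [Finset.lt_inf'_iff]
      intro i hi
      exact hr (hfin.mem_toFinset.mp hi)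

theorem decRearr_antitone {x : ℕ → ℝ} (h1 : ∀ i, x i ≤ 1) : Antitone (decRearr x) := by
  intro m n hmn
  refine le_of_forall_lt fun t ht => ?_
  rw [lt_decRearr_iff h1] at ht ⊢
  refine le_trans ?_ ht
  exact_mod_cast Nat.succ_le_succ hmn

theorem decRearr_nonneg {x : ℕ → ℝ} (h0 : ∀ i, 0 ≤ x i) (h1 : ∀ i, x i ≤ 1) (n : ℕ) :
    0 ≤ decRearr x n := by
  refine le_of_forall_lt fun t ht => ?_
  rw [lt_decRearr_iff h1]
  have : {i | t < x i} = Set.univ := Set.eq_univ_of_forall fun i => ht.trans_le (h0 i)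
  rw [this, Set.encard_univ, ENat.card_eq_top_of_infinite]
  exact le_top

theorem tsum_ofReal_eq_lintegral (x : ℕ → ℝ) :
    ∑' i, ENNReal.ofReal (x i) =
      ∫⁻ t in Set.Ici (0 : ℝ), ({i | t < x i}.encard : ℝ≥0∞) := by
  have hm : ∀ i, Measurable (Set.indicator (Set.Iio (x i)) (1 : ℝ → ℝ≥0∞)) := fun i =>
    measurable_one.indicator measurableSet_Iio
  have key : ∀ t : ℝ, ({i | t < x i}.encard : ℝ≥0∞) =
      ∑' i, Set.indicator (Set.Iio (x i)) (1 : ℝ → ℝ≥0∞) t := by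
    intro t
    rw [← ENNReal.tsum_set_one, tsum_subtype {i | t < x i} (fun _ => (1 : ℝ≥0∞))]
    refine tsum_congr fun i => ?_
    simp [Set.indicator_apply]
  simp_rw [key]
  rw [lintegral_tsum fun i => (hm i).aemeasurable]
  refine tsum_congr fun i => ?_
  rw [lintegral_indicator_one measurableSet_Iio, Measure.restrict_apply measurableSet_Iio,
    Set.inter_comm, Set.Ici_inter_Iio, Real.volume_Ico, sub_zero]

theorem tsum_decRearr {x : ℕ → ℝ} (h1 : ∀ i, x i ≤ 1) :
    ∑' n, ENNReal.ofReal (decRearr x n) = ∑' i, ENNReal.ofReal (x i) := by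
  rw [tsum_ofReal_eq_lintegral, tsum_ofReal_eq_lintegral]
  congr 1
  funext t
  congr 1
  simp_rw [lt_decRearr_iff h1]
  generalize {i | t < x i}.encard = c
  induction c using ENat.recTopCoe with
  | top => simp
  | coe m =>
    have : {n : ℕ | ((n + 1 : ℕ) : ℕ∞) ≤ (m : ℕ∞)} = (Finset.range m : Set ℕ) := by
      ext n
      simp only [Set.mem_ofPred_eq, Nat.cast_le, Finset.coe_range, Set.mem_Iio]
      omega
    rw [this, Set.encard_coe_eq_coe_finsetCard, Finset.card_range]

theorem decRearr_mem {x : ℕ → ℝ} (h0 : ∀ i, 0 ≤ x i) (h1 : HasSum x 1) :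
    decRearr x ∈ Delta1 := by
  have hle := le_one_of_hasSum h0 h1
  have hn := decRearr_nonneg h0 hle
  have hs : HasSum (decRearr x) 1 := by
    have e : ∑' n, ENNReal.ofReal (decRearr x n) = 1 := by
      rw [tsum_decRearr hle, ← ENNReal.ofReal_tsum_of_nonneg h0 h1.summable, h1.tsum_eq,
        ENNReal.ofReal_one]
    have hsum : Summable (decRearr x) := by
      have := ENNReal.summable_toReal (f := fun n => ENNReal.ofReal (decRearr x n)) (by simp [e])
      simpa [ENNReal.toReal_ofReal, hn] using this
    rw [← ENNReal.ofReal_tsum_of_nonneg hn hsum, ENNReal.ofReal_eq_one] at e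
    exact e ▸ hsum.hasSum
  exact ⟨fun n => ⟨hn n, le_one_of_hasSum hn hs n⟩, decRearr_antitone hle, hs⟩

theorem splitSeq_nonneg (i : ℕ) (u : unitInterval) (p : Delta1) (k : ℕ) :
    0 ≤ splitSeq i u p.1 k := by
  cases k with
  | zero => exact mul_nonneg u.2.1 (p.2.1 i).1
  | succ k =>
    simp only [splitSeq, Function.update_apply]
    split_ifs
    · exact mul_nonneg (sub_nonneg.mpr u.2.2) (p.2.1 i).1
    · exact (p.2.1 k).1

theorem splitSeq_hasSum (i : ℕ) (u : unitInterval) (p : Delta1) :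
    HasSum (splitSeq i u p.1) 1 := by
  rw [← hasSum_nat_add_iff' 1]
  have h := p.2.2.2.update i ((1 - (u : ℝ)) * p.1 i)
  have e : (1 - (u : ℝ)) * p.1 i - p.1 i + 1 =
      1 - ∑ k ∈ Finset.range 1, splitSeq i u p.1 k := by
    simp [splitSeq]; ring
  rw [e] at h
  exact h

theorem mergeSeq_nonneg (i j : ℕ) (p : Delta1) (k : ℕ) : 0 ≤ mergeSeq i j p.1 k := by
  simp only [mergeSeq, Function.update_apply]
  split_ifs
  · exact add_nonneg (p.2.1 i).1 (p.2.1 j).1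
  · exact le_rfl
  · exact (p.2.1 k).1

theorem mergeSeq_hasSum {i j : ℕ} (hij : i ≠ j) (p : Delta1) : HasSum (mergeSeq i j p.1) 1 := by
  have h := (p.2.2.2.update j 0).update i (p.1 i + p.1 j)
  rw [Function.update_of_ne hij] at h
  have e : p.1 i + p.1 j - p.1 i + (0 - p.1 j + 1) = 1 := by ring
  rw [e] at h
  exact h

end Facts

/-- The split operator `S_i^u : Δ₁ → Δ₁`. -/
def split (i : ℕ) (u : unitInterval) (p : Delta1) : Delta1 :=
  ⟨decRearr (splitSeq i u p.1), decRearr_mem (splitSeq_nonneg i u p) (splitSeq_hasSum i u p)⟩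

/-- The merge operator `M_{ij} : Δ₁ → Δ₁`, for `i ≠ j`. -/
def merge (ij : {ij : ℕ × ℕ // ij.1 ≠ ij.2}) (p : Delta1) : Delta1 :=
  ⟨decRearr (mergeSeq ij.1.1 ij.1.2 p.1),
    decRearr_mem (mergeSeq_nonneg _ _ p) (mergeSeq_hasSum ij.2 p)⟩

/-- The measure `K_{βs,βm}(p, ·)`: the part `p_i` is split at a uniform point with probability
`βs p_i²`, the ordered pair `(p_i, p_j)`, `i ≠ j`, is merged with probability `βm p_i p_j`, and
otherwise `p` does not move. The measure `∫₀¹ δ_{S_i^u p} du` is the image of Lebesgue measure on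
`[0,1]` under `u ↦ S_i^u p`. -/
def splitMergeMeasure (βs βm : ℝ) (p : Delta1) : Measure Delta1 :=
  ENNReal.ofReal βs • Measure.sum (fun i : ℕ =>
      ENNReal.ofReal (p.1 i ^ 2) • (volume : Measure unitInterval).map (fun u => split i u p))
  + ENNReal.ofReal βm • Measure.sum (fun ij : {ij : ℕ × ℕ // ij.1 ≠ ij.2} =>
      ENNReal.ofReal (p.1 ij.1.1 * p.1 ij.1.2) • Measure.dirac (merge ij p))
  + ENNReal.ofReal (1 - βs * ∑' i, p.1 i ^ 2
      - βm * ∑' ij : {ij : ℕ × ℕ // ij.1 ≠ ij.2}, p.1 ij.1.1 * p.1 ij.1.2) • Measure.dirac p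

section Measurability

theorem measurable_decRearr : Measurable decRearr := by
  refine measurable_pi_lambda _ fun n => ?_
  unfold decRearr
  refine Measurable.iSup fun s => ?_
  have hne : s.1.Nonempty := Finset.card_pos.mp (s.2.symm ▸ Nat.succ_pos n)
  have h : Measurable (s.1.inf' hne fun i => fun x : ℕ → ℝ => x i) :=
    Finset.inf'_induction hne _ (fun _ hf _ hg => Measurable.inf hf hg)
      fun i _ => measurable_pi_apply i
  convert h using 1
  funext x
  rw [Finset.inf'_apply]

theorem measurable_split (i : ℕ) :
    Measurable fun q : Delta1 × unitInterval => split i q.2 q.1 := by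
  refine Measurable.subtype_mk (measurable_decRearr.comp (measurable_pi_lambda _ fun k => ?_))
  have hp : ∀ j, Measurable fun q : Delta1 × unitInterval => q.1.1 j := fun j =>
    (measurable_pi_apply j).comp (measurable_subtype_coe.comp measurable_fst)
  have hu : Measurable fun q : Delta1 × unitInterval => (q.2 : ℝ) :=
    measurable_subtype_coe.comp measurable_snd
  cases k with
  | zero => exact hu.mul (hp i)
  | succ k =>
    simp only [splitSeq, Function.update_apply]
    split_ifs
    · exact (measurable_const.sub hu).mul (hp i)
    · exact hp k

theorem measurable_split_left (i : ℕ) (p : Delta1) :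
    Measurable fun u : unitInterval => split i u p := by
  have hu : Measurable fun u : unitInterval => (p, u) := measurable_prodMk_left
  have h := (measurable_split i).comp hu
  simp only [Function.comp_def] at h
  exact h

theorem measurable_map_split_apply (i : ℕ) {A : Set Delta1} (hA : MeasurableSet A) :
    Measurable fun p : Delta1 => (volume : Measure unitInterval).map (fun u => split i u p) A := by
  have h := measurable_measure_prodMk_left (ν := (volume : Measure unitInterval))
    (measurable_split i hA)
  convert h using 2 with p
  rw [Measure.map_apply (measurable_split_left i p) hA]
  rfl

theorem measurable_merge (ij : {ij : ℕ × ℕ // ij.1 ≠ ij.2}) : Measurable (merge ij) := by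
  refine Measurable.subtype_mk (measurable_decRearr.comp (measurable_pi_lambda _ fun k => ?_))
  have hp : ∀ j, Measurable fun q : Delta1 => q.1 j := fun j =>
    (measurable_pi_apply j).comp measurable_subtype_coe
  simp only [mergeSeq, Function.update_apply]
  split_ifs
  · exact (hp _).add (hp _)
  · exact measurable_const
  · exact hp k

theorem measurable_tsum_nonneg {ι : Type*} [Countable ι] {f : ι → Delta1 → ℝ}
    (hf : ∀ i, Measurable (f i)) (h0 : ∀ i p, 0 ≤ f i p) :
    Measurable fun p => ∑' i, f i p := by
  have : (fun p => ∑' i, f i p) = fun p => (∑' i, ENNReal.ofReal (f i p)).toReal := by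
    funext p
    rw [ENNReal.tsum_toReal_eq fun i => ENNReal.ofReal_ne_top]
    exact tsum_congr fun i => (ENNReal.toReal_ofReal (h0 i p)).symm
  rw [this]
  exact (Measurable.tsum fun i => (hf i).ennreal_ofReal).ennreal_toReal

theorem measurable_splitMergeMeasure (βs βm : ℝ) : Measurable (splitMergeMeasure βs βm) := by
  have hp : ∀ j, Measurable fun q : Delta1 => q.1 j := fun j =>
    (measurable_pi_apply j).comp measurable_subtype_coe
  refine Measure.measurable_of_measurable_coe _ fun A hA => ?_
  simp only [splitMergeMeasure, Measure.add_apply, Measure.smul_apply, Measure.sum_apply _ hA,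
    smul_eq_mul]
  refine ((Measurable.const_mul (Measurable.tsum fun i => ?_) _).add
    (Measurable.const_mul (Measurable.tsum fun ij => ?_) _)).add ?_
  · exact ((hp i).pow_const 2).ennreal_ofReal.mul (measurable_map_split_apply i hA)
  · refine ((hp _).mul (hp _)).ennreal_ofReal.mul ?_
    exact (Measure.measurable_coe hA).comp (Measure.measurable_dirac.comp (measurable_merge ij))
  · refine Measurable.mul (Measurable.ennreal_ofReal ?_)
      ((Measure.measurable_coe hA).comp Measure.measurable_dirac)
    refine (measurable_const.sub (Measurable.const_mul (measurable_tsum_nonneg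
      (fun i => (hp i).pow_const 2) fun i p => sq_nonneg _) _)).sub
      (Measurable.const_mul (measurable_tsum_nonneg (fun ij => (hp _).mul (hp _))
        fun ij p => mul_nonneg (p.2.1 _).1 (p.2.1 _).1) _)

end Measurability

/-- The transition kernel `K_{βs,βm}` of the uniform `(βs, βm)` split–merge chain. -/
def splitMergeKernel (βs βm : ℝ) : Kernel Delta1 Delta1 where
  toFun := splitMergeMeasure βs βm
  measurable' := measurable_splitMergeMeasure βs βm

theorem isMarkovKernel_splitMergeKernel {βs βm : ℝ} (hs : βs ∈ Set.Ioc (0 : ℝ) 1)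
    (hm : βm ∈ Set.Ioc (0 : ℝ) 1) : IsMarkovKernel (splitMergeKernel βs βm) := by
  refine ⟨fun p => ⟨?_⟩⟩
  change splitMergeMeasure βs βm p Set.univ = 1
  have hp0 : ∀ i, 0 ≤ p.1 i := fun i => (p.2.1 i).1
  have hsum : Summable p.1 := p.2.2.2.summable
  have hps : Summable fun ij : ℕ × ℕ => p.1 ij.1 * p.1 ij.2 :=
    hsum.mul_of_nonneg hsum hp0 hp0
  have hpt : ∑' ij : ℕ × ℕ, p.1 ij.1 * p.1 ij.2 = 1 := by
    rw [← hsum.tsum_mul_tsum hsum hps, p.2.2.2.tsum_eq, one_mul]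
  have hsq : Summable fun i => p.1 i ^ 2 := by
    refine Summable.of_nonneg_of_le (fun i => sq_nonneg _) (fun i => ?_) hsum
    nlinarith [hp0 i, (p.2.1 i).2]
  have hoff : Summable fun ij : {ij : ℕ × ℕ // ij.1 ≠ ij.2} => p.1 ij.1.1 * p.1 ij.1.2 :=
    hps.subtype {ij : ℕ × ℕ | ij.1 ≠ ij.2}
  have hoff0 : ∀ ij : {ij : ℕ × ℕ // ij.1 ≠ ij.2}, 0 ≤ p.1 ij.1.1 * p.1 ij.1.2 := fun ij =>
    mul_nonneg (hp0 _) (hp0 _)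
  have htot : ∑' i, p.1 i ^ 2 +
      ∑' ij : {ij : ℕ × ℕ // ij.1 ≠ ij.2}, p.1 ij.1.1 * p.1 ij.1.2 = 1 := by
    rw [← hpt, ← hps.tsum_subtype_add_tsum_subtype_compl {ij : ℕ × ℕ | ij.1 = ij.2}]
    congr 1
    let e : ℕ ≃ {ij : ℕ × ℕ | ij.1 = ij.2} :=
      { toFun := fun i => ⟨(i, i), rfl⟩
        invFun := fun ij => ij.1.1
        left_inv := fun _ => rfl
        right_inv := by rintro ⟨⟨i, j⟩, h⟩; cases h; rfl }
    rw [← e.tsum_eq]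
    exact tsum_congr fun i => sq _
  have hA0 : 0 ≤ ∑' i, p.1 i ^ 2 := tsum_nonneg fun i => sq_nonneg _
  have hB0 : 0 ≤ ∑' ij : {ij : ℕ × ℕ // ij.1 ≠ ij.2}, p.1 ij.1.1 * p.1 ij.1.2 := tsum_nonneg hoff0
  have hmap : ∀ i, (volume : Measure unitInterval).map (fun u => split i u p) Set.univ = 1 := by
    intro i
    rw [Measure.map_apply (measurable_split_left i p) MeasurableSet.univ, Set.preimage_univ, measure_univ]
  simp only [splitMergeMeasure, Measure.add_apply, Measure.smul_apply,
    Measure.sum_apply _ MeasurableSet.univ, smul_eq_mul, hmap, measure_univ, mul_one]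
  rw [← ENNReal.ofReal_tsum_of_nonneg (fun i => sq_nonneg _) hsq,
    ← ENNReal.ofReal_tsum_of_nonneg hoff0 hoff, ← ENNReal.ofReal_mul hs.1.le,
    ← ENNReal.ofReal_mul hm.1.le, ← ENNReal.ofReal_add (mul_nonneg hs.1.le hA0)
    (mul_nonneg hm.1.le hB0), ← ENNReal.ofReal_add (add_nonneg (mul_nonneg hs.1.le hA0)
    (mul_nonneg hm.1.le hB0)) (by nlinarith [hs.2, hm.2]), ENNReal.ofReal_eq_one]
  ring

theorem measurableSet_Delta1 : MeasurableSet Delta1 := by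
  have hp : ∀ j, Measurable fun x : ℕ → ℝ => x j := fun j => measurable_pi_apply j
  have e : Delta1 = (⋂ i, {x : ℕ → ℝ | 0 ≤ x i ∧ x i ≤ 1}) ∩ ((⋂ i, {x | x (i + 1) ≤ x i}) ∩
      {x | ∑' i, ENNReal.ofReal (x i) = 1}) := by
    ext x
    simp only [Delta1, Set.mem_inter_iff, Set.mem_iInter, Set.mem_ofPred_eq, Set.mem_Icc]
    refine and_congr_right fun h => and_congr
      ⟨fun ha i => ha i.le_succ, fun ha => antitone_nat_of_succ_le ha⟩ ?_
    have h0 : ∀ i, 0 ≤ x i := fun i => (h i).1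
    constructor
    · intro hs
      rw [← ENNReal.ofReal_tsum_of_nonneg h0 hs.summable, hs.tsum_eq, ENNReal.ofReal_one]
    · intro hs
      have hsum : Summable x := by
        have := ENNReal.summable_toReal (f := fun n => ENNReal.ofReal (x n)) (by simp [hs])
        simpa [ENNReal.toReal_ofReal, h0] using this
      rw [← ENNReal.ofReal_tsum_of_nonneg h0 hsum, ENNReal.ofReal_eq_one] at hs
      exact hs ▸ hsum.hasSum
  rw [e]
  refine (MeasurableSet.iInter fun i => ?_).inter ((MeasurableSet.iInter fun i => ?_).inter ?_)
  · exact (measurableSet_le measurable_const (hp i)).inter (measurableSet_le (hp i) measurable_const)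
  · exact measurableSet_le (hp _) (hp _)
  · exact (Measurable.tsum fun i => (hp i).ennreal_ofReal) (measurableSet_singleton 1)

/-- Stick breaking: the `k`-th block takes the fraction `t k` of the mass that is not yet
allocated. -/
def stickBreaking (t : ℕ → ℝ) (k : ℕ) : ℝ :=
  t k * ∏ j ∈ Finset.range k, (1 - t j)

/-- The Poisson–Dirichlet law `PD_θ` on `Δ₁`, `θ > 0`: the law of the decreasing rearrangement of
the stick-breaking sequence built from independent Beta(1, θ) variables. The law is formed on
`ℕ → ℝ` and then regarded as a measure on the measurable subset `Δ₁`. -/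
def poissonDirichlet (θ : ℝ) : Measure Delta1 :=
  ((Measure.infinitePi fun _ : ℕ => betaMeasure 1 θ).map
    fun t => decRearr (stickBreaking t)).comap Subtype.val

end SplitMerge

end

/-!
The proof replaces the sorted sequence of law `PD_θ` by the unsorted stick-breaking sequence, whose
law is `stickLaw (betaMeasure 1 θ)`, and reads the terms of the kernel as size-biased picks: the
weight `p_i ^ 2` picks the same part twice, the weight `p_i p_j` picks two distinct parts. All
functions involved depend on a sequence only through its collection of parts (`SameParts`), so that
sums over the parts do not see the order (`sizeBiasedSum_eq_of_sameParts`).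

The key fact is that a size-biased pick from the stick-breaking sequence, together with the
collection of the remaining parts, has the law of the first part together with the rest
(`lintegral_sizeBiasedSum`). The stick-breaking sequence is a first part `t` followed by an
independent copy of itself scaled by `1 - t` (`lintegral_stickLaw`). A size-biased pick is thus `t`,
with probability `t`, or else a pick from the scaled copy; and the first part satisfies the same
recursion, since the first two parts are exchangeable once reweighted by `1 - t`
(`lintegral_first_two_swap`). The recursion is affine in the test function with a linear part that
contracts by the factor `∫ (1 - t) < 1`, so the two laws agree.

Hence one pick has the law of `t`, and a pick of two distinct parts that of `(t, (1 - t) s)`,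
weighted by `1 - t`. The latter has the density `θ² (1 - x - y) ^ (θ - 1)`, which depends on
`x + y` only and is also the density of `(u t, (1 - u) t)` for a uniform `u`, weighted by `θ t`
(`lintegral_first_split`). So splits, at rate `βs = θ βm`, carry the parts picked twice into pairs
of distinct parts (`lintegral_splitPick`), merges carry these back (`lintegral_mergePick`), and the
flows cancel.
-/

namespace SplitMerge

/-! ### Sequences as collections of parts -/

/-- The sequence with first entry `a` and remaining entries `x`. -/
def cons (a : ℝ) (x : ℕ → ℝ) : ℕ → ℝ
  | 0 => a
  | k + 1 => x k

@[simp] theorem cons_zero (a : ℝ) (x : ℕ → ℝ) : cons a x 0 = a := rfl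

@[simp] theorem cons_succ (a : ℝ) (x : ℕ → ℝ) (k : ℕ) : cons a x (k + 1) = x k := rfl

theorem smul_cons (c a : ℝ) (x : ℕ → ℝ) : c • cons a x = cons (c * a) (c • x) := by
  funext k
  cases k <;> simp

theorem update_cons_zero (a b : ℝ) (x : ℕ → ℝ) : Function.update (cons a x) 0 b = cons b x := by
  funext k
  cases k <;> simp

theorem update_cons_succ (a b : ℝ) (x : ℕ → ℝ) (i : ℕ) :
    Function.update (cons a x) (i + 1) b = cons a (Function.update x i b) := by
  funext k
  cases k <;> simp [Function.update_apply]

theorem smul_update_zero (c : ℝ) (x : ℕ → ℝ) (i : ℕ) :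
    c • Function.update x i 0 = Function.update (c • x) i 0 := by
  funext k
  by_cases h : k = i <;> simp [h]

theorem measurable_comp₂ {α β γ δ : Type*} [MeasurableSpace α] [MeasurableSpace β]
    [MeasurableSpace γ] [MeasurableSpace δ] {F : β → γ → δ} {f : α → β} {g : α → γ}
    (hF : Measurable fun q : β × γ => F q.1 q.2) (hf : Measurable f) (hg : Measurable g) :
    Measurable fun a => F (f a) (g a) :=
  hF.comp (hf.prodMk hg)

theorem measurable_cons : Measurable fun q : ℝ × (ℕ → ℝ) => cons q.1 q.2 := by
  refine measurable_pi_lambda _ fun k => ?_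
  cases k with
  | zero => exact measurable_fst
  | succ k => exact (measurable_pi_apply k).comp measurable_snd

@[fun_prop]
theorem measurable_update_zero (i : ℕ) : Measurable fun x : ℕ → ℝ => Function.update x i 0 := by
  refine measurable_pi_lambda _ fun k => ?_
  simp only [Function.update_apply]
  split_ifs
  · exact measurable_const
  · exact measurable_pi_apply k

/-- Two sequences of nonnegative numbers with finite sum have the same positive parts, with
multiplicity: above every level `t ≥ 0` they have the same number of entries. The number of zero
entries is irrelevant. -/
structure SameParts (x x' : ℕ → ℝ) : Prop where
  nonneg_left : ∀ i, 0 ≤ x i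
  nonneg_right : ∀ i, 0 ≤ x' i
  summable_left : Summable x
  summable_right : Summable x'
  encard_eq : ∀ t, 0 ≤ t → {i | t < x i}.encard = {i | t < x' i}.encard

namespace SameParts

variable {x x' : ℕ → ℝ}

theorem symm (h : SameParts x x') : SameParts x' x :=
  ⟨h.2, h.1, h.4, h.3, fun t ht => (h.5 t ht).symm⟩

theorem trans {x'' : ℕ → ℝ} (h : SameParts x x') (h' : SameParts x' x'') : SameParts x x'' :=
  ⟨h.1, h'.2, h.3, h'.4, fun t ht => (h.5 t ht).trans (h'.5 t ht)⟩

theorem smul (h : SameParts x x') {c : ℝ} (hc : 0 ≤ c) : SameParts (c • x) (c • x') := by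
  refine ⟨fun i => mul_nonneg hc (h.1 i), fun i => mul_nonneg hc (h.2 i),
    h.3.const_smul c, h.4.const_smul c, fun t ht => ?_⟩
  rcases hc.eq_or_lt with rfl | hc
  · simp
  · have e : ∀ y : ℕ → ℝ, {i | t < (c • y) i} = {i | t / c < y i} := fun y => by
      ext i
      simp [div_lt_iff₀ hc, mul_comm]
    rw [e, e]
    exact h.5 _ (div_nonneg ht hc.le)

end SameParts

theorem summable_cons {a : ℝ} {x : ℕ → ℝ} (hx : Summable x) : Summable (cons a x) :=
  (summable_nat_add_iff 1).mp hx

theorem cons_nonneg {a : ℝ} {x : ℕ → ℝ} (ha : 0 ≤ a) (hx : ∀ i, 0 ≤ x i) (i : ℕ) :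
    0 ≤ cons a x i := by
  cases i
  · exact ha
  · exact hx _

theorem encard_cons (a t : ℝ) (x : ℕ → ℝ) :
    {i | t < cons a x i}.encard = {i | t < x i}.encard + if t < a then 1 else 0 := by
  have hs : {i | t < cons a x i} =
      Nat.succ '' {i | t < x i} ∪ (if t < a then {0} else ∅) := by
    ext i
    cases i <;> by_cases h : t < a <;> simp [h]
  rw [hs, Set.encard_union_eq, Nat.succ_injective.encard_image]
  · split_ifs <;> simp
  · split_ifs <;> simp

theorem SameParts.cons {x x' : ℕ → ℝ} (h : SameParts x x') {a : ℝ} (ha : 0 ≤ a) :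
    SameParts (cons a x) (cons a x') :=
  ⟨cons_nonneg ha h.1, cons_nonneg ha h.2, summable_cons h.3, summable_cons h.4,
    fun t ht => by rw [encard_cons, encard_cons, h.5 t ht]⟩

theorem sameParts_cons_zero {x : ℕ → ℝ} (h0 : ∀ i, 0 ≤ x i) (hs : Summable x) :
    SameParts (cons 0 x) x :=
  ⟨cons_nonneg le_rfl h0, h0, summable_cons hs, hs,
    fun t ht => by rw [encard_cons, if_neg ht.not_gt, add_zero]⟩

theorem update_zero_nonneg {x : ℕ → ℝ} (h0 : ∀ i, 0 ≤ x i) (i k : ℕ) :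
    0 ≤ Function.update x i 0 k := by
  rw [Function.update_apply]
  split_ifs
  · exact le_rfl
  · exact h0 k

theorem encard_eq_update_zero (x : ℕ → ℝ) (i : ℕ) {t : ℝ} (ht : 0 ≤ t) :
    {k | t < x k}.encard =
      {k | t < Function.update x i 0 k}.encard + if t < x i then 1 else 0 := by
  have hs : {k | t < Function.update x i 0 k} = {k | t < x k} \ {i} := by
    ext k
    by_cases h : k = i <;> simp [h, ht]
  rw [hs]
  split_ifs with h
  · exact (Set.encard_sdiff_singleton_add_one (s := {k | t < x k}) h).symm
  · rw [Set.sdiff_singleton_eq_self (by simpa using h), add_zero]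

/-- Moving the `i`-th entry to the front does not change the collection of parts. -/
theorem sameParts_cons_update {x : ℕ → ℝ} (h0 : ∀ i, 0 ≤ x i) (hs : Summable x) (i : ℕ) :
    SameParts x (cons (x i) (Function.update x i 0)) :=
  ⟨h0, cons_nonneg (h0 i) (update_zero_nonneg h0 i), hs, summable_cons (hs.update i 0),
    fun t ht => by rw [encard_cons, ← encard_eq_update_zero x i ht]⟩

theorem sameParts_decRearr {x : ℕ → ℝ} (h0 : ∀ i, 0 ≤ x i) (h1 : HasSum x 1) :
    SameParts (decRearr x) x := by
  have hm := decRearr_mem h0 h1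
  refine ⟨fun i => (hm.1 i).1, h0, hm.2.2.summable, h1.summable, fun t ht => ?_⟩
  simp_rw [lt_decRearr_iff (le_one_of_hasSum h0 h1)]
  generalize {i | t < x i}.encard = c
  induction c using ENat.recTopCoe with
  | top => simp
  | coe m =>
    have : {n : ℕ | ((n + 1 : ℕ) : ℕ∞) ≤ (m : ℕ∞)} = (Finset.range m : Set ℕ) := by
      ext n
      simp only [Set.mem_ofPred_eq, Nat.cast_le, Finset.coe_range, Set.mem_Iio]
      omega
    rw [this, Set.encard_coe_eq_coe_finsetCard, Finset.card_range]

/-! ### Sums over the parts -/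

theorem finite_lt_of_summable {x : ℕ → ℝ} (hs : Summable x) {t : ℝ} (ht : 0 < t) :
    {i | t < x i}.Finite := by
  have h := hs.tendsto_cofinite_zero.eventually (gt_mem_nhds ht)
  rw [Filter.eventually_cofinite] at h
  exact h.subset fun i hi => not_lt.mpr (le_of_lt hi)

namespace SameParts

variable {x x' : ℕ → ℝ}

theorem encard_le_le (h : SameParts x x') {v : ℝ} (hv : 0 < v) :
    {i | v ≤ x i}.encard ≤ {i | v ≤ x' i}.encard := by
  -- just below `v` there is a level that separates `v` from the smaller entries of `x'`
  have hfin : {i | v / 2 < x' i ∧ x' i < v}.Finite :=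
    (finite_lt_of_summable h.4 (half_pos hv)).subset fun i hi => hi.1
  have hev : ∀ᶠ t in nhdsWithin v (Set.Iio v), ∀ i ∈ {i | v / 2 < x' i ∧ x' i < v}, x' i < t := by
    rw [hfin.eventually_all]
    exact fun i hi => Filter.mem_of_superset (Ioo_mem_nhdsLT hi.2) fun t ht => ht.1
  obtain ⟨t, ht, htv⟩ := (hev.and (Ioo_mem_nhdsLT (half_lt_self hv))).exists
  calc {i | v ≤ x i}.encard ≤ {i | t < x i}.encard :=
        Set.encard_le_encard fun i hi => htv.2.trans_le hi
    _ = {i | t < x' i}.encard := h.5 t (by linarith [htv.1])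
    _ ≤ {i | v ≤ x' i}.encard := by
        refine Set.encard_le_encard fun i hi => ?_
        by_contra hlt
        have hi' : t < x' i := hi
        exact lt_asymm hi' (ht i ⟨htv.1.trans hi', not_le.mp hlt⟩)

theorem encard_fiber_eq (h : SameParts x x') {v : ℝ} (hv : 0 < v) :
    {i | x i = v}.encard = {i | x' i = v}.encard := by
  have key : ∀ y : ℕ → ℝ, {i | v ≤ y i}.encard = {i | v < y i}.encard + {i | y i = v}.encard := by
    intro y
    rw [← Set.encard_union_eq]
    · congr 1
      ext i
      simp [le_iff_lt_or_eq, eq_comm]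
    · exact Set.disjoint_left.mpr fun i (hi : v < y i) (hi' : y i = v) => hi.ne' hi'
  have h1 := le_antisymm (h.encard_le_le hv) (h.symm.encard_le_le hv)
  rw [key, key, h.5 v hv.le] at h1
  exact ENat.add_right_injective_of_ne_top (finite_lt_of_summable h.4 hv).encard_lt_top.ne h1

/-- Sequences with the same parts are matched by a bijection of their positive entries. -/
theorem exists_equiv (h : SameParts x x') :
    ∃ e : {i // 0 < x i} ≃ {i // 0 < x' i}, ∀ i, x' (e i) = x i := by
  have hfib : ∀ v : ℝ, Nonempty
      ({a : {i // 0 < x i} // x a = v} ≃ {a : {i // 0 < x' i} // x' a = v}) := by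
    intro v
    rcases le_or_gt v 0 with hv | hv
    · have : IsEmpty {a : {i // 0 < x i} // x a = v} :=
        ⟨fun a => (a.1.2.trans_le (a.2.le.trans hv)).false⟩
      have : IsEmpty {a : {i // 0 < x' i} // x' a = v} :=
        ⟨fun a => (a.1.2.trans_le (a.2.le.trans hv)).false⟩
      exact ⟨Equiv.equivOfIsEmpty _ _⟩
    · have e : ∀ y : ℕ → ℝ, {a : {i // 0 < y i} // y a = v} ≃ {i | y i = v} := fun y =>
        Equiv.subtypeSubtypeEquivSubtype (p := fun i => 0 < y i) (q := fun i => y i = v)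
          fun {i} hi => by rw [hi]; exact hv
      have hf : ∀ {y : ℕ → ℝ}, Summable y → {i | y i = v}.Finite := fun hy =>
        (finite_lt_of_summable hy (half_pos hv)).subset fun i (hi : _ = v) => by
          change v / 2 < _
          rw [hi]
          exact half_lt_self hv
      have := (hf h.3).to_subtype
      have := (hf h.4).to_subtype
      obtain ⟨g⟩ := Finite.card_eq (α := {i | x i = v}) (β := {i | x' i = v}) |>.mp
        (congrArg ENat.toNat (h.encard_fiber_eq hv))
      exact ⟨(e x).trans (g.trans (e x').symm)⟩
  exact ⟨Equiv.ofFiberEquiv (f := fun a : {i // 0 < x i} => x a)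
    (g := fun a : {i // 0 < x' i} => x' a) fun v => (hfib v).some,
    fun i => Equiv.ofFiberEquiv_map (f := fun a : {i // 0 < x i} => x a)
    (g := fun a : {i // 0 < x' i} => x' a) (fun v => (hfib v).some) i⟩

/-- Removing equal entries preserves the relation of having the same parts. -/
theorem update_zero (h : SameParts x x') {i j : ℕ} (hij : x i = x' j) :
    SameParts (Function.update x i 0) (Function.update x' j 0) := by
  refine ⟨update_zero_nonneg h.1 i, update_zero_nonneg h.2 j, h.3.update i 0, h.4.update j 0,
    fun t ht => ?_⟩
  have h5 := h.5 t ht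
  rw [encard_eq_update_zero x i ht, encard_eq_update_zero x' j ht, hij] at h5
  refine ENat.add_left_injective_of_ne_top (n := if t < x' j then 1 else 0) ?_ h5
  split_ifs <;> simp

end SameParts

/-- A function of a part and of the sequence of the remaining parts is symmetric if it depends on
the sequence only through the collection of its parts. -/
def IsSymmetric (F : ℝ → (ℕ → ℝ) → ℝ≥0∞) : Prop :=
  ∀ y, 0 ≤ y → ∀ x x', SameParts x x' → F y x = F y x'

/-- The sum over all entries `x i`, weighted by their sizes, of the value of `F` at the entry and
at the remaining entries. For `x` with sum `1` this is the mean of `F` for a size-biased pick. The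
picked entry is replaced by `0`. -/
noncomputable def sizeBiasedSum (F : ℝ → (ℕ → ℝ) → ℝ≥0∞) (x : ℕ → ℝ) : ℝ≥0∞ :=
  ∑' i, ENNReal.ofReal (x i) * F (x i) (Function.update x i 0)

theorem sizeBiasedSum_eq_of_sameParts {F : ℝ → (ℕ → ℝ) → ℝ≥0∞} (hF : IsSymmetric F)
    {x x' : ℕ → ℝ} (h : SameParts x x') : sizeBiasedSum F x = sizeBiasedSum F x' := by
  obtain ⟨e, he⟩ := h.exists_equiv
  have key : ∀ y : ℕ → ℝ, (∑' i : {i | 0 < y i},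
      ENNReal.ofReal (y i) * F (y i) (Function.update y i 0)) = sizeBiasedSum F y := fun y => by
    refine tsum_subtype_eq_of_support_subset (s := {i | 0 < y i}) (f := fun i =>
      ENNReal.ofReal (y i) * F (y i) (Function.update y i 0)) fun i hi => ?_
    by_contra hn
    exact hi (by simp [ENNReal.ofReal_of_nonpos (not_lt.mp hn)])
  rw [← key, ← key]
  refine (tsum_congr fun i => ?_).trans (e.tsum_eq fun i =>
    ENNReal.ofReal (x' i) * F (x' i) (Function.update x' i 0))
  have hi := he i
  rw [← hi]
  congr 1
  exact hF _ (h.2 _) _ _ (h.update_zero hi.symm)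

theorem measurable_sizeBiasedSum {F : ℝ → (ℕ → ℝ) → ℝ≥0∞}
    (hF : Measurable fun q : ℝ × (ℕ → ℝ) => F q.1 q.2) : Measurable (sizeBiasedSum F) := by
  refine Measurable.tsum fun i => ?_
  exact (measurable_pi_apply i).ennreal_ofReal.mul
    (hF.comp ((measurable_pi_apply i).prodMk (measurable_update_zero i)))

/-! ### The law of the unsorted stick-breaking sequence -/

theorem stickBreaking_cons (a : ℝ) (s : ℕ → ℝ) :
    stickBreaking (cons a s) = cons a ((1 - a) • stickBreaking s) := by
  funext k
  cases k with
  | zero => simp [stickBreaking]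
  | succ k =>
    simp only [stickBreaking, cons_succ, Finset.prod_range_succ', cons_zero, Pi.smul_apply,
      smul_eq_mul]
    ring

theorem measurable_stickBreaking : Measurable stickBreaking := by
  refine measurable_pi_lambda _ fun k => ?_
  unfold stickBreaking
  fun_prop

theorem sum_stickBreaking (t : ℕ → ℝ) (n : ℕ) :
    ∑ k ∈ Finset.range n, stickBreaking t k = 1 - ∏ j ∈ Finset.range n, (1 - t j) := by
  induction n with
  | zero => simp
  | succ n ih =>
    rw [Finset.sum_range_succ, ih, Finset.prod_range_succ, stickBreaking]
    ring

theorem stickBreaking_nonneg {t : ℕ → ℝ} (ht : ∀ i, t i ∈ Set.Ioo (0 : ℝ) 1) (k : ℕ) :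
    0 ≤ stickBreaking t k :=
  mul_nonneg (ht k).1.le (Finset.prod_nonneg fun j _ => sub_nonneg.mpr (ht j).2.le)

theorem tsum_ofReal_stickBreaking_le {t : ℕ → ℝ} (ht : ∀ i, t i ∈ Set.Ioo (0 : ℝ) 1) :
    ∑' k, ENNReal.ofReal (stickBreaking t k) ≤ 1 := by
  rw [ENNReal.tsum_eq_iSup_nat]
  refine iSup_le fun n => ?_
  rw [← ENNReal.ofReal_sum_of_nonneg fun k _ => stickBreaking_nonneg ht k, sum_stickBreaking]
  refine ENNReal.ofReal_le_one.mpr (sub_le_self _ ?_)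
  exact Finset.prod_nonneg fun j _ => sub_nonneg.mpr (ht j).2.le

theorem hasSum_one_of_tsum_ofReal {x : ℕ → ℝ} (h0 : ∀ i, 0 ≤ x i)
    (h : ∑' i, ENNReal.ofReal (x i) = 1) : HasSum x 1 := by
  have hs : Summable x := by
    have := ENNReal.summable_toReal (f := fun n => ENNReal.ofReal (x n)) (by simp [h])
    simpa [ENNReal.toReal_ofReal, h0] using this
  rw [← ENNReal.ofReal_tsum_of_nonneg h0 hs, ENNReal.ofReal_eq_one] at h
  exact h ▸ hs.hasSum

/-- A family of independent variables indexed by `ℕ` is the first one followed by an independent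
copy of the whole family. -/
theorem map_cons_prod_infinitePi (b : Measure ℝ) [IsProbabilityMeasure b] :
    (b.prod (Measure.infinitePi fun _ : ℕ => b)).map (fun q => cons q.1 q.2) =
      Measure.infinitePi fun _ : ℕ => b := by
  classical
  refine Measure.eq_infinitePi _ fun s t ht => ?_
  obtain ⟨n, hn⟩ : ∃ n, s ⊆ Finset.range (n + 1) :=
    ⟨s.sup id, fun i hi => Finset.mem_range_succ_iff.mpr (Finset.le_sup (f := id) hi)⟩
  let T : ℕ → Set ℝ := fun i => if i ∈ s then t i else Set.univ
  have hT : ∀ i, MeasurableSet (T i) := fun i => by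
    by_cases h : i ∈ s <;> simp [T, h, ht]
  have hpre : (fun q : ℝ × (ℕ → ℝ) => cons q.1 q.2) ⁻¹' (Set.pi s t) =
      T 0 ×ˢ Set.pi (Finset.range n) fun i => T (i + 1) := by
    ext q
    simp only [Set.mem_preimage, Set.mem_pi, Set.mem_prod, SetLike.mem_coe]
    constructor
    · refine fun h => ⟨?_, fun i _ => ?_⟩
      · by_cases h0 : 0 ∈ s
        · simpa [T, h0] using h 0 h0
        · simp [T, h0]
      · by_cases hi : i + 1 ∈ s
        · simpa [T, hi] using h (i + 1) hi
        · simp [T, hi]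
    · rintro ⟨h0, h⟩ i hi
      cases i with
      | zero => simpa [T, hi] using h0
      | succ i =>
        have := h i (by simpa using hn hi)
        simpa [T, hi] using this
  rw [Measure.map_apply measurable_cons (MeasurableSet.pi (Finset.countable_toSet s)
    fun i _ => ht i), hpre, Measure.prod_prod, Measure.infinitePi_pi _ fun i _ => hT (i + 1),
    mul_comm, ← Finset.prod_range_succ' (fun i => b (T i)),
    ← Finset.prod_subset hn fun i _ hi => by simp [T, hi]]
  exact Finset.prod_congr rfl fun i hi => by simp [T, hi]

/-- The law of the stick-breaking sequence built from independent variables with law `b`; for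
`b = Beta(1, θ)` it is the Griffiths–Engen–McCloskey law. -/
noncomputable def stickLaw (b : Measure ℝ) : Measure (ℕ → ℝ) :=
  (Measure.infinitePi fun _ : ℕ => b).map stickBreaking

section StickLaw

variable (b : Measure ℝ) [IsProbabilityMeasure b]

instance : IsProbabilityMeasure (stickLaw b) :=
  Measure.isProbabilityMeasure_map measurable_stickBreaking.aemeasurable

/-- The stick-breaking sequence is self-similar: once the first part `t` is removed, the rest is
an independent copy of the whole sequence, scaled by `1 - t`. -/
theorem lintegral_stickLaw {F : (ℕ → ℝ) → ℝ≥0∞} (hF : Measurable F) :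
    ∫⁻ x, F x ∂stickLaw b = ∫⁻ t, ∫⁻ x, F (cons t ((1 - t) • x)) ∂stickLaw b ∂b := by
  have hc : Measurable fun q : ℝ × (ℕ → ℝ) => F (cons q.1 ((1 - q.1) • q.2)) :=
    hF.comp (measurable_comp₂ measurable_cons (by fun_prop) (by fun_prop))
  rw [stickLaw, lintegral_map hF measurable_stickBreaking]
  conv_lhs => rw [← map_cons_prod_infinitePi b]
  rw [lintegral_map (f := fun t => F (stickBreaking t)) (hF.comp measurable_stickBreaking)
    measurable_cons, lintegral_prod]
  · refine lintegral_congr fun t => ?_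
    rw [lintegral_map (f := fun x => F (cons t ((1 - t) • x)))
      (hc.comp measurable_prodMk_left) measurable_stickBreaking]
    simp only [stickBreaking_cons]
  · exact ((hF.comp measurable_stickBreaking).comp measurable_cons).aemeasurable

variable {b}

theorem lintegral_one_sub_lt_one (hb : ∀ᵐ t ∂b, t ∈ Set.Ioo (0 : ℝ) 1) :
    ∫⁻ t, ENNReal.ofReal (1 - t) ∂b < 1 := by
  have h1 : ∫⁻ t, ENNReal.ofReal (1 - t) ∂b + ∫⁻ t, ENNReal.ofReal t ∂b = 1 := by
    rw [← lintegral_add_left (by fun_prop), ← measure_univ (μ := b), ← lintegral_one]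
    refine lintegral_congr_ae (hb.mono fun t ht => ?_)
    change ENNReal.ofReal (1 - t) + ENNReal.ofReal t = 1
    rw [← ENNReal.ofReal_add (sub_nonneg.mpr ht.2.le) ht.1.le, sub_add_cancel, ENNReal.ofReal_one]
  have h2 : ∫⁻ t, ENNReal.ofReal t ∂b ≠ 0 := by
    rw [Ne, lintegral_eq_zero_iff (by fun_prop)]
    intro h
    obtain ⟨t, ht, ht'⟩ := (h.and hb).exists
    exact (ENNReal.ofReal_pos.mpr ht'.1).ne' ht
  have h3 : ∫⁻ t, ENNReal.ofReal (1 - t) ∂b ≠ ⊤ := fun h => by simp [h] at h1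
  calc _ < _ := ENNReal.lt_add_right h3 h2
    _ = 1 := h1

theorem ae_stickLaw_nonneg_and_le (hb : ∀ᵐ t ∂b, t ∈ Set.Ioo (0 : ℝ) 1) :
    ∀ᵐ x ∂stickLaw b, (∀ i, 0 ≤ x i) ∧ ∑' i, ENNReal.ofReal (x i) ≤ 1 := by
  have hm : MeasurableSet {x : ℕ → ℝ | (∀ i, 0 ≤ x i) ∧ ∑' i, ENNReal.ofReal (x i) ≤ 1} := by
    refine MeasurableSet.inter (?_ : MeasurableSet {x : ℕ → ℝ | ∀ i, 0 ≤ x i})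
      (measurableSet_le (f := fun x : ℕ → ℝ => ∑' i, ENNReal.ofReal (x i)) (by fun_prop)
        measurable_const)
    rw [Set.ofPred_forall]
    exact MeasurableSet.iInter fun i => measurableSet_le measurable_const (measurable_pi_apply i)
  rw [stickLaw, ae_map_iff measurable_stickBreaking.aemeasurable hm]
  have hall : ∀ᵐ t ∂Measure.infinitePi fun _ : ℕ => b, ∀ i, t i ∈ Set.Ioo (0 : ℝ) 1 := by
    rw [ae_all_iff]
    intro i
    exact (measurePreserving_eval_infinitePi (fun _ : ℕ => b) i).quasiMeasurePreserving.ae hb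
  exact hall.mono fun t ht => ⟨stickBreaking_nonneg ht, tsum_ofReal_stickBreaking_le ht⟩

/-- Stick breaking exhausts the stick: by self-similarity the mean `m` of the mass that is never
allocated satisfies `m = m ∫ (1 - t) db`, so that `m = 0`. -/
theorem ae_stickLaw_hasSum (hb : ∀ᵐ t ∂b, t ∈ Set.Ioo (0 : ℝ) 1) :
    ∀ᵐ x ∂stickLaw b, (∀ i, 0 ≤ x i) ∧ HasSum x 1 := by
  set L : (ℕ → ℝ) → ℝ≥0∞ := fun x => 1 - ∑' i, ENNReal.ofReal (x i) with hL
  have hLm : Measurable L := by fun_prop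
  have hrec : ∫⁻ x, L x ∂stickLaw b =
      (∫⁻ t, ENNReal.ofReal (1 - t) ∂b) * ∫⁻ x, L x ∂stickLaw b := by
    conv_lhs => rw [lintegral_stickLaw b hLm]
    rw [← lintegral_mul_const _ (by fun_prop)]
    refine lintegral_congr_ae (hb.mono fun t ht => ?_)
    change _ = _ * _
    rw [← lintegral_const_mul _ hLm]
    refine lintegral_congr fun x => ?_
    simp only [hL]
    rw [tsum_eq_zero_add' ENNReal.summable]
    simp only [cons_zero, cons_succ, Pi.smul_apply, smul_eq_mul]
    simp_rw [ENNReal.ofReal_mul (sub_nonneg.mpr ht.2.le)]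
    rw [ENNReal.tsum_mul_left, ← tsub_tsub, ENNReal.mul_sub fun _ _ => ENNReal.ofReal_ne_top,
      mul_one, ENNReal.ofReal_sub _ ht.1.le, ENNReal.ofReal_one]
  have hfin : ∫⁻ x, L x ∂stickLaw b ≠ ⊤ := by
    refine ne_top_of_le_ne_top ENNReal.one_ne_top ?_
    calc _ ≤ ∫⁻ _, 1 ∂stickLaw b := lintegral_mono fun x => tsub_le_self
      _ = 1 := by simp
  have hzero : ∫⁻ x, L x ∂stickLaw b = 0 := by
    by_contra h0
    have := ENNReal.mul_lt_mul_left h0 hfin (lintegral_one_sub_lt_one hb)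
    rw [one_mul, ← hrec] at this
    exact this.false
  rw [lintegral_eq_zero_iff hLm] at hzero
  filter_upwards [hzero, ae_stickLaw_nonneg_and_le hb] with x hx hx'
  exact ⟨hx'.1, hasSum_one_of_tsum_ofReal hx'.1 (le_antisymm hx'.2 (tsub_eq_zero_iff_le.mp hx))⟩

end StickLaw

/-! ### The law of the first two parts -/

theorem beta_one_left {θ : ℝ} (hθ : 0 < θ) : beta 1 θ = θ⁻¹ := by
  rw [beta, Real.Gamma_one, one_mul, add_comm, Real.Gamma_add_one hθ.ne',
    div_mul_cancel_right₀ (Real.Gamma_pos_of_pos hθ).ne']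

theorem betaPDF_one_left {θ t : ℝ} (hθ : 0 < θ) (ht : t ∈ Set.Ioo (0 : ℝ) 1) :
    betaPDF 1 θ t = ENNReal.ofReal θ * ENNReal.ofReal ((1 - t) ^ (θ - 1)) := by
  rw [betaPDF_of_pos_lt_one ht.1 ht.2, beta_one_left hθ, sub_self, Real.rpow_zero, one_div,
    inv_inv, mul_one, ENNReal.ofReal_mul hθ.le]

theorem measurable_betaPDF (α β : ℝ) : Measurable (betaPDF α β) :=
  (measurable_betaPDFReal α β).ennreal_ofReal

theorem lintegral_betaMeasure {α β : ℝ} {f : ℝ → ℝ≥0∞} (hf : Measurable f) :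
    ∫⁻ t, f t ∂betaMeasure α β = ∫⁻ t, betaPDF α β t * f t := by
  rw [betaMeasure, lintegral_withDensity_eq_lintegral_mul _ (measurable_betaPDF α β) hf]
  rfl

theorem ae_betaMeasure_mem_Ioo (α β : ℝ) : ∀ᵐ t ∂betaMeasure α β, t ∈ Set.Ioo (0 : ℝ) 1 := by
  rw [betaMeasure, ae_withDensity_iff (measurable_betaPDF α β)]
  refine Filter.Eventually.of_forall fun t ht => ⟨?_, ?_⟩ <;> by_contra h
  · exact ht (betaPDF_eq_zero_of_nonpos (not_lt.mp h))
  · exact ht (betaPDF_eq_zero_of_one_le (not_lt.mp h))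

theorem ofReal_mul_lintegral_comp_mul {c : ℝ} (hc : 0 < c) {g : ℝ → ℝ≥0∞} (hg : Measurable g) :
    ENNReal.ofReal c * ∫⁻ s, g (c * s) = ∫⁻ y, g y := by
  conv_rhs => rw [← Real.smul_map_volume_mul_left hc.ne', abs_of_pos hc, lintegral_smul_measure,
    lintegral_map hg (measurable_const_mul c)]
  rfl

/-- The density `θ² (1 - x - y)^(θ - 1)` on the triangle `x, y > 0`, `x + y < 1`, that is, the
density of `(T, (1 - T) T')` for independent Beta(1, θ) variables `T`, `T'`, reweighted by
`1 - T`. -/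
noncomputable def pairDensity (θ x y : ℝ) : ℝ≥0∞ :=
  if 0 < x ∧ 0 < y then ENNReal.ofReal θ * betaPDF 1 θ (x + y) else 0

theorem pairDensity_comm (θ x y : ℝ) : pairDensity θ x y = pairDensity θ y x := by
  simp only [pairDensity, add_comm, and_comm]

theorem measurable_pairDensity (θ : ℝ) :
    Measurable fun q : ℝ × ℝ => pairDensity θ q.1 q.2 := by
  refine Measurable.ite ?_ ?_ measurable_const
  · exact (measurableSet_lt measurable_const measurable_fst).inter
      (measurableSet_lt measurable_const measurable_snd)
  · exact ((measurable_betaPDF 1 θ).comp (measurable_fst.add measurable_snd)).const_mul _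

theorem betaPDF_mul_betaPDF {θ : ℝ} (hθ : 0 < θ) {t : ℝ} (ht : t ∈ Set.Ioo (0 : ℝ) 1) (s : ℝ) :
    betaPDF 1 θ t * betaPDF 1 θ s = pairDensity θ t ((1 - t) * s) := by
  have h1 : 0 < 1 - t := sub_pos.mpr ht.2
  have hid : 1 - (t + (1 - t) * s) = (1 - t) * (1 - s) := by ring
  rcases le_or_gt s 0 with hs | hs
  · rw [betaPDF_eq_zero_of_nonpos hs, mul_zero, pairDensity,
      if_neg fun h => (mul_nonpos_of_nonneg_of_nonpos h1.le hs).not_gt h.2]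
  rw [pairDensity, if_pos ⟨ht.1, mul_pos h1 hs⟩]
  rcases le_or_gt 1 s with hs1 | hs1
  · have : (1 - t) * (1 - s) ≤ 0 := mul_nonpos_of_nonneg_of_nonpos h1.le (sub_nonpos.mpr hs1)
    rw [betaPDF_eq_zero_of_one_le hs1,
      betaPDF_eq_zero_of_one_le (x := t + (1 - t) * s) (by linarith),
      mul_zero, mul_zero]
  · have h2 : 0 < 1 - s := sub_pos.mpr hs1
    have hmem : t + (1 - t) * s ∈ Set.Ioo (0 : ℝ) 1 :=
      ⟨add_pos ht.1 (mul_pos h1 hs), by linarith [mul_pos h1 h2]⟩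
    rw [betaPDF_one_left hθ ht, betaPDF_one_left hθ ⟨hs, hs1⟩, betaPDF_one_left hθ hmem, hid,
      Real.mul_rpow h1.le h2.le, ENNReal.ofReal_mul (Real.rpow_nonneg h1.le _)]
    ring

section Pair

variable {θ : ℝ} {H : ℝ → ℝ → ℝ≥0∞}

theorem lintegral_first_two (hθ : 0 < θ) (hH : Measurable fun q : ℝ × ℝ => H q.1 q.2) :
    ∫⁻ t, ∫⁻ s, ENNReal.ofReal (1 - t) * H t ((1 - t) * s) ∂betaMeasure 1 θ ∂betaMeasure 1 θ =
      ∫⁻ x, ∫⁻ y, pairDensity θ x y * H x y := by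
  have := isProbabilityMeasureBeta one_pos hθ
  have hm : Measurable fun q : ℝ × ℝ =>
      ENNReal.ofReal (1 - q.1) * H q.1 ((1 - q.1) * q.2) :=
    (measurable_const.sub measurable_fst).ennreal_ofReal.mul
      (hH.comp (measurable_fst.prodMk
      ((measurable_const.sub measurable_fst).mul measurable_snd)))
  rw [lintegral_betaMeasure (f := fun t => ∫⁻ s, ENNReal.ofReal (1 - t) * H t ((1 - t) * s)
    ∂betaMeasure 1 θ) hm.lintegral_prod_right']
  refine lintegral_congr fun t => ?_
  by_cases ht : t ∈ Set.Ioo (0 : ℝ) 1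
  · have hHt : Measurable (H t) := hH.comp measurable_prodMk_left
    have hg : Measurable fun y => pairDensity θ t y * H t y :=
      ((measurable_pairDensity θ).mul hH).comp measurable_prodMk_left
    have hHt' : Measurable fun s => H t ((1 - t) * s) := hHt.comp (measurable_const_mul _)
    have hwH : Measurable fun s => betaPDF 1 θ s * H t ((1 - t) * s) :=
      (measurable_betaPDF 1 θ).mul hHt'
    rw [← ofReal_mul_lintegral_comp_mul (sub_pos.mpr ht.2) hg, lintegral_const_mul _ hHt',
      lintegral_betaMeasure hHt', mul_left_comm, ← lintegral_const_mul _ hwH]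
    congr 1
    refine lintegral_congr fun s => ?_
    rw [← mul_assoc, betaPDF_mul_betaPDF hθ ht]
  · have h0 : ∀ y, pairDensity θ t y = 0 := by
      intro y
      rw [pairDensity]
      split_ifs with h
      · rw [betaPDF_eq_zero_of_one_le, mul_zero]
        by_contra h1
        exact ht ⟨h.1, by linarith [h.2]⟩
      · rfl
    have hw : betaPDF 1 θ t = 0 := by
      rcases le_or_gt t 0 with h | h
      · exact betaPDF_eq_zero_of_nonpos h
      · exact betaPDF_eq_zero_of_one_le (not_lt.mp fun h' => ht ⟨h, h'⟩)
    simp [h0, hw]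

/-- Up to the factor `1 - t`, the first two parts `t`, `(1 - t) s` are exchangeable. -/
theorem lintegral_first_two_swap (hθ : 0 < θ) (hH : Measurable fun q : ℝ × ℝ => H q.1 q.2) :
    ∫⁻ t, ∫⁻ s, ENNReal.ofReal (1 - t) * H ((1 - t) * s) t ∂betaMeasure 1 θ ∂betaMeasure 1 θ =
      ∫⁻ t, ∫⁻ s, ENNReal.ofReal (1 - t) * H t ((1 - t) * s) ∂betaMeasure 1 θ ∂betaMeasure 1 θ := by
  rw [lintegral_first_two hθ hH,
    lintegral_first_two (H := fun x y => H y x) hθ (hH.comp measurable_swap)]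
  have hm : Measurable fun q : ℝ × ℝ => pairDensity θ q.1 q.2 * H q.2 q.1 :=
    (measurable_pairDensity θ).mul (hH.comp measurable_swap)
  rw [lintegral_lintegral_swap hm.aemeasurable]
  simp_rw [pairDensity_comm θ]

theorem lintegral_unitInterval (f : ℝ → ℝ≥0∞) (hf : Measurable f) :
    ∫⁻ u : unitInterval, f u = ∫⁻ u, if 0 < u ∧ u < 1 then f u else 0 := by
  rw [unitInterval.measurePreserving_coe.lintegral_comp hf,
    ← Measure.restrict_congr_set Ioo_ae_eq_Icc, ← lintegral_indicator measurableSet_Ioo]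
  simp only [Set.indicator_apply, Set.mem_Ioo]

/-- Splitting the first part uniformly yields, up to constants and a change of the weight, the
first two parts. This is the identity that relates splits to merges. -/
theorem lintegral_first_split (hθ : 0 < θ) (hH : Measurable fun q : ℝ × ℝ => H q.1 q.2) :
    ENNReal.ofReal θ * ∫⁻ t, (ENNReal.ofReal t *
        ∫⁻ u : unitInterval, H (u * t) ((1 - u) * t)) ∂betaMeasure 1 θ =
      ∫⁻ t, ∫⁻ s, ENNReal.ofReal (1 - t) * H t ((1 - t) * s)
        ∂betaMeasure 1 θ ∂betaMeasure 1 θ := by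
  rw [lintegral_first_two hθ hH]
  -- the integrand in the coordinates `t = x + y` and `x`
  set A : ℝ → ℝ → ℝ≥0∞ := fun t x => pairDensity θ x (t - x) * H x (t - x) with hA
  have hAm : Measurable fun q : ℝ × ℝ => A q.1 q.2 :=
    ((measurable_pairDensity θ).mul hH).comp
      (measurable_snd.prodMk (measurable_fst.sub measurable_snd))
  have hHm : Measurable fun q : ℝ × unitInterval => H (q.2 * q.1) ((1 - q.2) * q.1) :=
    hH.comp (Measurable.prodMk (by fun_prop) (by fun_prop))
  have hR : ∫⁻ x, ∫⁻ y, pairDensity θ x y * H x y = ∫⁻ t, ∫⁻ x, A t x := by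
    symm
    rw [lintegral_lintegral_swap hAm.aemeasurable]
    refine lintegral_congr fun x => ?_
    rw [← lintegral_add_left_eq_self (fun t => A t x) x]
    simp [hA]
  have hm1 : Measurable fun t : ℝ => ENNReal.ofReal t *
      ∫⁻ u : unitInterval, H (u * t) ((1 - u) * t) :=
    measurable_id.ennreal_ofReal.mul hHm.lintegral_prod_right'
  have hm2 : Measurable fun t : ℝ => betaPDF 1 θ t * (ENNReal.ofReal t *
      ∫⁻ u : unitInterval, H (u * t) ((1 - u) * t)) := (measurable_betaPDF 1 θ).mul hm1
  rw [hR, lintegral_betaMeasure hm1, ← lintegral_const_mul _ hm2]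
  refine lintegral_congr fun t => ?_
  rcases le_or_gt t 0 with ht | ht
  · have h0 : ∀ x, A t x = 0 := fun x => by
      rw [hA]
      simp only
      rw [pairDensity, if_neg fun h => by linarith [h.1, h.2], zero_mul]
    simp [h0, betaPDF_eq_zero_of_nonpos ht]
  · have hHt : Measurable fun u : ℝ => H (u * t) ((1 - u) * t) :=
      hH.comp (Measurable.prodMk (by fun_prop) (by fun_prop))
    have hAt : Measurable (A t) := hAm.comp measurable_prodMk_left
    have hite : Measurable fun u : ℝ => if 0 < u ∧ u < 1 then H (u * t) ((1 - u) * t) else 0 :=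
      Measurable.ite measurableSet_Ioo hHt measurable_const
    have hassoc : ∀ a b c d : ℝ≥0∞, a * (b * (c * d)) = c * (a * b * d) := fun a b c d => by ring
    rw [← ofReal_mul_lintegral_comp_mul ht hAt, lintegral_unitInterval _ hHt, hassoc,
      ← lintegral_const_mul _ hite]
    congr 1
    refine lintegral_congr fun u => ?_
    have hiff : (0 < t * u ∧ 0 < t - t * u) ↔ (0 < u ∧ u < 1) := by
      rw [mul_pos_iff_of_pos_left ht, show t - t * u = t * (1 - u) by ring,
        mul_pos_iff_of_pos_left ht, sub_pos]
    simp only [hA, pairDensity, hiff]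
    split_ifs
    · rw [show t - t * u = (1 - u) * t by ring, mul_comm t u,
        show u * t + (1 - u) * t = t by ring]
    · simp

end Pair

/-! ### Size-biased picks -/

/-- The effect on `F` of removing the first part `t` when the picked part is not the first one:
the picked part and the rest are scaled by `1 - t`, and `t` joins the rest. -/
noncomputable def skipFirst (b : Measure ℝ) (F : ℝ → (ℕ → ℝ) → ℝ≥0∞) (y : ℝ) (x : ℕ → ℝ) :
    ℝ≥0∞ :=
  ∫⁻ t, ENNReal.ofReal (1 - t) * F ((1 - t) * y) (cons t ((1 - t) • x)) ∂b

section SkipFirst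

variable {b : Measure ℝ} {F : ℝ → (ℕ → ℝ) → ℝ≥0∞}

theorem measurable_skipFirst_integrand (hF : Measurable fun q : ℝ × (ℕ → ℝ) => F q.1 q.2) :
    Measurable fun r : (ℝ × (ℕ → ℝ)) × ℝ => ENNReal.ofReal (1 - r.2) *
      F ((1 - r.2) * r.1.1) (cons r.2 ((1 - r.2) • r.1.2)) :=
  (measurable_const.sub measurable_snd).ennreal_ofReal.mul
    (measurable_comp₂ hF (by fun_prop)
      (measurable_comp₂ measurable_cons (by fun_prop) (by fun_prop)))

theorem measurable_skipFirst [SFinite b] (hF : Measurable fun q : ℝ × (ℕ → ℝ) => F q.1 q.2) :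
    Measurable fun q : ℝ × (ℕ → ℝ) => skipFirst b F q.1 q.2 :=
  (measurable_skipFirst_integrand hF).lintegral_prod_right'

theorem isSymmetric_skipFirst (hb : ∀ᵐ t ∂b, t ∈ Set.Ioo (0 : ℝ) 1) (hs : IsSymmetric F) :
    IsSymmetric (skipFirst b F) := by
  intro y hy x x' h
  refine lintegral_congr_ae (hb.mono fun t ht => ?_)
  have h1 : 0 ≤ 1 - t := sub_nonneg.mpr ht.2.le
  exact congrArg (ENNReal.ofReal (1 - t) * ·)
    (hs _ (mul_nonneg h1 hy) _ _ ((h.smul h1).cons ht.1.le))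

theorem skipFirst_le {C : ℝ≥0∞} (hC : ∀ y x, F y x ≤ C) (y : ℝ) (x : ℕ → ℝ) :
    skipFirst b F y x ≤ C * ∫⁻ t, ENNReal.ofReal (1 - t) ∂b := by
  rw [← lintegral_const_mul _ (by fun_prop)]
  refine lintegral_mono fun t => ?_
  simp only
  rw [mul_comm C]
  gcongr
  exact hC _ _

/-- A size-biased pick from the stick-breaking sequence is either the first part `t`, or a
size-biased pick from the remaining sequence. -/
theorem lintegral_sizeBiasedSum_eq_add [IsProbabilityMeasure b]
    (hb : ∀ᵐ t ∂b, t ∈ Set.Ioo (0 : ℝ) 1)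
    (hF : Measurable fun q : ℝ × (ℕ → ℝ) => F q.1 q.2) (hs : IsSymmetric F) :
    ∫⁻ x, sizeBiasedSum F x ∂stickLaw b =
      ∫⁻ t, ∫⁻ x, ENNReal.ofReal t * F t ((1 - t) • x) ∂stickLaw b ∂b +
        ∫⁻ x, sizeBiasedSum (skipFirst b F) x ∂stickLaw b := by
  have hterm : ∀ i : ℕ, Measurable fun r : (ℕ → ℝ) × ℝ => ENNReal.ofReal (r.1 i) *
      (ENNReal.ofReal (1 - r.2) *
        F ((1 - r.2) * r.1 i) (cons r.2 ((1 - r.2) • Function.update r.1 i 0))) := fun i =>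
    ((measurable_pi_apply i).comp measurable_fst).ennreal_ofReal.mul
      ((measurable_skipFirst_integrand hF).comp
        ((((measurable_pi_apply i).comp measurable_fst).prodMk
          ((measurable_update_zero i).comp measurable_fst)).prodMk measurable_snd))
  have hsum : ∫⁻ x, sizeBiasedSum (skipFirst b F) x ∂stickLaw b =
      ∫⁻ t, ∫⁻ x, ∑' i, ENNReal.ofReal (x i) * (ENNReal.ofReal (1 - t) *
        F ((1 - t) * x i) (cons t ((1 - t) • Function.update x i 0))) ∂stickLaw b ∂b := by
    rw [← lintegral_lintegral_swap (f := fun (x : ℕ → ℝ) (t : ℝ) =>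
      ∑' i, ENNReal.ofReal (x i) * (ENNReal.ofReal (1 - t) *
        F ((1 - t) * x i) (cons t ((1 - t) • Function.update x i 0))))
      (Measurable.tsum hterm).aemeasurable]
    refine lintegral_congr fun x => ?_
    have hx : ∀ i : ℕ, Measurable fun t => ENNReal.ofReal (x i) * (ENNReal.ofReal (1 - t) *
        F ((1 - t) * x i) (cons t ((1 - t) • Function.update x i 0))) := fun i =>
      (hterm i).comp measurable_prodMk_left
    rw [lintegral_tsum fun i => (hx i).aemeasurable]
    refine tsum_congr fun i => ?_
    rw [skipFirst, lintegral_const_mul]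
    exact (measurable_skipFirst_integrand hF).comp
      (measurable_prodMk_left (x := (x i, Function.update x i 0)))
  have hm : Measurable fun q : ℝ × (ℕ → ℝ) => ENNReal.ofReal q.1 * F q.1 ((1 - q.1) • q.2) :=
    measurable_fst.ennreal_ofReal.mul (measurable_comp₂ hF measurable_fst (by fun_prop))
  rw [lintegral_stickLaw b (measurable_sizeBiasedSum hF), hsum,
    ← lintegral_add_left hm.lintegral_prod_right']
  refine lintegral_congr_ae (hb.mono fun t ht => ?_)
  have h1 : 0 ≤ 1 - t := sub_nonneg.mpr ht.2.le
  simp only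
  have hmt : Measurable fun x : ℕ → ℝ => ENNReal.ofReal t * F t ((1 - t) • x) :=
    hm.comp measurable_prodMk_left
  rw [← lintegral_add_left hmt]
  refine lintegral_congr_ae ((ae_stickLaw_hasSum hb).mono fun x hx => ?_)
  simp only
  rw [sizeBiasedSum, tsum_eq_zero_add' ENNReal.summable]
  simp only [cons_zero, cons_succ, update_cons_zero, update_cons_succ, Pi.smul_apply, smul_eq_mul]
  have hz : SameParts (cons 0 ((1 - t) • x)) ((1 - t) • x) :=
    sameParts_cons_zero (fun i => mul_nonneg h1 (hx.1 i)) (hx.2.summable.const_smul (1 - t))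
  rw [hs t ht.1.le _ _ hz]
  congr 1
  refine tsum_congr fun i => ?_
  rw [smul_update_zero, ENNReal.ofReal_mul h1]
  ring

end SkipFirst

section SizeBias

variable {θ : ℝ} {F : ℝ → (ℕ → ℝ) → ℝ≥0∞}

/-- The first part of the sequence built from Beta(1, θ) variables satisfies the same recursion as
a size-biased pick, because the first two parts are exchangeable up to the factor `1 - t`. -/
theorem lintegral_first_eq_add (hθ : 0 < θ)
    (hF : Measurable fun q : ℝ × (ℕ → ℝ) => F q.1 q.2) :
    ∫⁻ t, ∫⁻ x, F t ((1 - t) • x) ∂stickLaw (betaMeasure 1 θ) ∂betaMeasure 1 θ =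
      ∫⁻ t, ∫⁻ x, ENNReal.ofReal t * F t ((1 - t) • x)
          ∂stickLaw (betaMeasure 1 θ) ∂betaMeasure 1 θ +
        ∫⁻ t, ∫⁻ x, skipFirst (betaMeasure 1 θ) F t ((1 - t) • x)
          ∂stickLaw (betaMeasure 1 θ) ∂betaMeasure 1 θ := by
  have := isProbabilityMeasureBeta one_pos hθ
  have hb := ae_betaMeasure_mem_Ioo 1 θ
  set b := betaMeasure 1 θ
  have hm : Measurable fun q : ℝ × (ℕ → ℝ) => ENNReal.ofReal q.1 * F q.1 ((1 - q.1) • q.2) :=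
    measurable_fst.ennreal_ofReal.mul (measurable_comp₂ hF measurable_fst (by fun_prop))
  -- the mean over the rest of the sequence, as a function of the first two parts
  set H : ℝ → ℝ → ℝ≥0∞ := fun y z => ∫⁻ x, F y (cons z ((1 - y - z) • x)) ∂stickLaw b with hH
  have hHm : Measurable fun q : ℝ × ℝ => H q.1 q.2 := by
    refine Measurable.lintegral_prod_right' (f := fun r : (ℝ × ℝ) × (ℕ → ℝ) =>
      F r.1.1 (cons r.1.2 ((1 - r.1.1 - r.1.2) • r.2))) ?_
    exact measurable_comp₂ hF (by fun_prop)
      (measurable_comp₂ measurable_cons (by fun_prop) (by fun_prop))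
  have hskip : ∫⁻ s, ∫⁻ x, skipFirst b F s ((1 - s) • x) ∂stickLaw b ∂b =
      ∫⁻ t, ∫⁻ s, ENNReal.ofReal (1 - t) * H ((1 - t) * s) t ∂b ∂b := by
    have hm4 : Measurable fun r : (ℝ × ℝ) × (ℕ → ℝ) => F ((1 - r.1.2) * r.1.1)
        (cons r.1.2 ((1 - (1 - r.1.2) * r.1.1 - r.1.2) • r.2)) :=
      measurable_comp₂ hF (by fun_prop)
      (measurable_comp₂ measurable_cons (by fun_prop) (by fun_prop))
    have hm2 : Measurable fun q : ℝ × ℝ =>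
        ENNReal.ofReal (1 - q.2) * H ((1 - q.2) * q.1) q.2 :=
      (measurable_const.sub measurable_snd).ennreal_ofReal.mul hm4.lintegral_prod_right'
    refine Eq.trans ?_ (lintegral_lintegral_swap hm2.aemeasurable)
    refine lintegral_congr fun s => ?_
    have hm3 : Measurable fun r : (ℕ → ℝ) × ℝ => ENNReal.ofReal (1 - r.2) *
        F ((1 - r.2) * s) (cons r.2 ((1 - r.2) • (1 - s) • r.1)) :=
      (measurable_const.sub measurable_snd).ennreal_ofReal.mul
        (measurable_comp₂ hF (by fun_prop)
      (measurable_comp₂ measurable_cons (by fun_prop) (by fun_prop)))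
    simp only [skipFirst]
    rw [lintegral_lintegral_swap hm3.aemeasurable]
    refine lintegral_congr fun t => ?_
    have hm5 : Measurable fun x : ℕ → ℝ => F ((1 - t) * s)
        (cons t ((1 - (1 - t) * s - t) • x)) :=
      hm4.comp (measurable_prodMk_left (x := (s, t)))
    simp only [hH]
    rw [← lintegral_const_mul _ hm5]
    refine lintegral_congr fun x => ?_
    rw [smul_smul, show (1 - t) * (1 - s) = 1 - (1 - t) * s - t by ring]
  have hrest : ∫⁻ t, ∫⁻ s, ENNReal.ofReal (1 - t) * H t ((1 - t) * s) ∂b ∂b =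
      ∫⁻ t, ∫⁻ x, ENNReal.ofReal (1 - t) * F t ((1 - t) • x) ∂stickLaw b ∂b := by
    refine lintegral_congr fun t => ?_
    have hFt : Measurable fun x => F t ((1 - t) • x) :=
      hF.comp (measurable_const.prodMk (by fun_prop))
    have hHt : Measurable fun s => H t ((1 - t) * s) :=
      hHm.comp (measurable_const.prodMk (by fun_prop))
    rw [lintegral_const_mul _ hHt, lintegral_const_mul _ hFt, lintegral_stickLaw b hFt]
    congr 1
    refine lintegral_congr fun s => lintegral_congr fun x => ?_
    rw [smul_cons, smul_smul, show (1 - t) * (1 - s) = 1 - t - (1 - t) * s by ring]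
  rw [hskip, lintegral_first_two_swap hθ hHm, hrest,
    ← lintegral_add_left hm.lintegral_prod_right']
  refine lintegral_congr_ae (hb.mono fun t ht => ?_)
  have hmt : Measurable fun x : ℕ → ℝ => ENNReal.ofReal t * F t ((1 - t) • x) :=
    hm.comp measurable_prodMk_left
  simp only
  rw [← lintegral_add_left hmt]
  refine lintegral_congr fun x => ?_
  rw [← add_mul, ← ENNReal.ofReal_add ht.1.le (sub_nonneg.mpr ht.2.le), add_sub_cancel,
    ENNReal.ofReal_one, one_mul]

/-- Bounded case of `lintegral_sizeBiasedSum`: both sides satisfy the same affine recursion, whose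
linear part contracts the bound on `F` by the factor `∫ (1 - t) < 1`. -/
theorem lintegral_sizeBiasedSum_of_le (hθ : 0 < θ)
    (hF : Measurable fun q : ℝ × (ℕ → ℝ) => F q.1 q.2) (hs : IsSymmetric F) {C : ℝ≥0∞}
    (hC : C ≠ ⊤) (hFC : ∀ y x, F y x ≤ C) :
    ∫⁻ x, sizeBiasedSum F x ∂stickLaw (betaMeasure 1 θ) =
      ∫⁻ t, ∫⁻ x, F t ((1 - t) • x) ∂stickLaw (betaMeasure 1 θ) ∂betaMeasure 1 θ := by
  have := isProbabilityMeasureBeta one_pos hθ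
  have hb := ae_betaMeasure_mem_Ioo 1 θ
  set b := betaMeasure 1 θ
  set c := ∫⁻ t, ENNReal.ofReal (1 - t) ∂b with hc
  have key : ∀ n : ℕ, ∀ (F : ℝ → (ℕ → ℝ) → ℝ≥0∞) (C : ℝ≥0∞),
      (Measurable fun q : ℝ × (ℕ → ℝ) => F q.1 q.2) → IsSymmetric F → (∀ y x, F y x ≤ C) →
      ∫⁻ x, sizeBiasedSum F x ∂stickLaw b ≤
        ∫⁻ t, ∫⁻ x, F t ((1 - t) • x) ∂stickLaw b ∂b + C * c ^ n ∧
      ∫⁻ t, ∫⁻ x, F t ((1 - t) • x) ∂stickLaw b ∂b ≤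
        ∫⁻ x, sizeBiasedSum F x ∂stickLaw b + C * c ^ n := by
    intro n
    induction n with
    | zero =>
      intro F C hF hs hFC
      rw [pow_zero, mul_one]
      constructor
      · refine le_add_left ?_
        calc ∫⁻ x, sizeBiasedSum F x ∂stickLaw b ≤ ∫⁻ _, C ∂stickLaw b := by
              refine lintegral_mono_ae ((ae_stickLaw_nonneg_and_le hb).mono fun x hx => ?_)
              calc sizeBiasedSum F x ≤ ∑' i, ENNReal.ofReal (x i) * C :=
                    ENNReal.tsum_le_tsum fun i => by gcongr; exact hFC _ _
                _ = (∑' i, ENNReal.ofReal (x i)) * C := ENNReal.tsum_mul_right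
                _ ≤ 1 * C := by gcongr; exact hx.2
                _ = C := one_mul C
          _ = C := by simp
      · refine le_add_left ?_
        calc ∫⁻ t, ∫⁻ x, F t ((1 - t) • x) ∂stickLaw b ∂b ≤ ∫⁻ _, ∫⁻ _, C ∂stickLaw b ∂b :=
              lintegral_mono fun t => lintegral_mono fun x => hFC _ _
          _ = C := by simp
    | succ n ih =>
      intro F C hF hs hFC
      obtain ⟨h1, h2⟩ := ih (skipFirst b F) (C * c) (measurable_skipFirst hF)
        (isSymmetric_skipFirst hb hs) (skipFirst_le hFC)
      rw [lintegral_sizeBiasedSum_eq_add hb hF hs, lintegral_first_eq_add hθ hF, pow_succ',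
        ← mul_assoc, add_assoc, add_assoc]
      exact ⟨by gcongr, by gcongr⟩
  have hlim : ∀ a : ℝ≥0∞, Filter.Tendsto (fun n => a + C * c ^ n) Filter.atTop (nhds a) := by
    intro a
    have h0 := ENNReal.Tendsto.const_mul (a := C)
      (ENNReal.tendsto_pow_atTop_nhds_zero_of_lt_one (lintegral_one_sub_lt_one hb)) (Or.inr hC)
    simpa using tendsto_const_nhds.add h0
  exact le_antisymm (ge_of_tendsto' (hlim _) fun n => (key n F C hF hs hFC).1)
    (ge_of_tendsto' (hlim _) fun n => (key n F C hF hs hFC).2)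

/-- Invariance under size-biased picks: a size-biased pick from the stick-breaking sequence,
together with the collection of the remaining parts, has the law of the first part together with
the collection of the remaining parts. -/
theorem lintegral_sizeBiasedSum (hθ : 0 < θ)
    (hF : Measurable fun q : ℝ × (ℕ → ℝ) => F q.1 q.2) (hs : IsSymmetric F) :
    ∫⁻ x, sizeBiasedSum F x ∂stickLaw (betaMeasure 1 θ) =
      ∫⁻ t, ∫⁻ x, F t ((1 - t) • x) ∂stickLaw (betaMeasure 1 θ) ∂betaMeasure 1 θ := by
  have := isProbabilityMeasureBeta one_pos hθ
  -- truncation at height `n`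
  set T : ℕ → ℝ → (ℕ → ℝ) → ℝ≥0∞ := fun n y x => F y x ⊓ n with hT
  have hTm : ∀ n, Measurable fun q : ℝ × (ℕ → ℝ) => T n q.1 q.2 := fun n =>
    hF.inf measurable_const
  have hmono : ∀ y x, Monotone fun n => T n y x := fun y x m n hmn =>
    inf_le_inf_left _ (by exact_mod_cast hmn)
  have hsup : ∀ y x, ⨆ n, T n y x = F y x := fun y x => by
    rw [hT]
    simp only
    rw [← inf_iSup_eq, ENNReal.iSup_natCast, inf_top_eq]
  have hsum : ∀ x, sizeBiasedSum F x = ⨆ n, sizeBiasedSum (T n) x := by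
    intro x
    simp only [sizeBiasedSum]
    simp_rw [← lintegral_count]
    rw [← lintegral_iSup (fun n => measurable_of_countable _)
      fun m n hmn i => by dsimp only; gcongr; exact hmono _ _ hmn]
    simp_rw [← ENNReal.mul_iSup, hsup]
  have hm : ∀ n, Measurable fun q : ℝ × (ℕ → ℝ) => T n q.1 ((1 - q.1) • q.2) := fun n =>
    measurable_comp₂ (hTm n) measurable_fst (by fun_prop)
  simp_rw [hsum]
  rw [lintegral_iSup (fun n => measurable_sizeBiasedSum (hTm n)) fun m n hmn x =>
    ENNReal.tsum_le_tsum fun i => by gcongr; exact hmono _ _ hmn]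
  have hinner : ∀ t, ∫⁻ x, F t ((1 - t) • x) ∂stickLaw (betaMeasure 1 θ) =
      ⨆ n, ∫⁻ x, T n t ((1 - t) • x) ∂stickLaw (betaMeasure 1 θ) := by
    intro t
    have hmt : ∀ n, Measurable fun x : ℕ → ℝ => T n t ((1 - t) • x) := fun n =>
      (hm n).comp measurable_prodMk_left
    rw [← lintegral_iSup hmt fun m n hmn x => hmono _ _ hmn]
    simp_rw [hsup]
  simp_rw [hinner]
  rw [lintegral_iSup (fun n => (hm n).lintegral_prod_right')
    fun m n hmn t => lintegral_mono fun x => hmono _ _ hmn]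
  refine iSup_congr fun n => ?_
  refine lintegral_sizeBiasedSum_of_le hθ (hTm n) (fun y hy x x' h => ?_)
    (ENNReal.natCast_ne_top n) fun y x => inf_le_right
  simp only [hT]
  rw [hs y hy x x' h]

/-- The sum over the second of two picked entries: `y` is the first one, `x` holds the others, and
the second one is weighted by its size. The size-biased sum of `secondPick G` runs over all ordered
pairs of distinct entries, see `sizeBiasedSum_secondPick`. -/
noncomputable def secondPick (G : ℝ → ℝ → (ℕ → ℝ) → ℝ≥0∞) (y : ℝ) (x : ℕ → ℝ) : ℝ≥0∞ :=
  sizeBiasedSum (G y) x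

theorem isSymmetric_secondPick {G : ℝ → ℝ → (ℕ → ℝ) → ℝ≥0∞}
    (hs : ∀ y, 0 ≤ y → IsSymmetric (G y)) : IsSymmetric (secondPick G) :=
  fun y hy _ _ h => sizeBiasedSum_eq_of_sameParts (hs y hy) h

theorem measurable_secondPick {G : ℝ → ℝ → (ℕ → ℝ) → ℝ≥0∞}
    (hG : Measurable fun q : ℝ × ℝ × (ℕ → ℝ) => G q.1 q.2.1 q.2.2) :
    Measurable fun q : ℝ × (ℕ → ℝ) => secondPick G q.1 q.2 := by
  refine Measurable.tsum fun i => ?_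
  have hi : Measurable fun q : ℝ × (ℕ → ℝ) => q.2 i := (measurable_pi_apply i).comp measurable_snd
  exact hi.ennreal_ofReal.mul (hG.comp
    (measurable_fst.prodMk (hi.prodMk ((measurable_update_zero i).comp measurable_snd))))

/-- Two successive size-biased picks have the law of the first two parts. -/
theorem lintegral_sizeBiasedSum_secondPick (hθ : 0 < θ) {G : ℝ → ℝ → (ℕ → ℝ) → ℝ≥0∞}
    (hG : Measurable fun q : ℝ × ℝ × (ℕ → ℝ) => G q.1 q.2.1 q.2.2)
    (hs : ∀ y, 0 ≤ y → IsSymmetric (G y)) :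
    ∫⁻ x, sizeBiasedSum (secondPick G) x ∂stickLaw (betaMeasure 1 θ) =
      ∫⁻ t, ∫⁻ s, ENNReal.ofReal (1 - t) * ∫⁻ x, G t ((1 - t) * s)
        ((1 - t - (1 - t) * s) • x) ∂stickLaw (betaMeasure 1 θ)
        ∂betaMeasure 1 θ ∂betaMeasure 1 θ := by
  have := isProbabilityMeasureBeta one_pos hθ
  rw [lintegral_sizeBiasedSum hθ (measurable_secondPick hG) (isSymmetric_secondPick hs)]
  refine lintegral_congr_ae ((ae_betaMeasure_mem_Ioo 1 θ).mono fun t ht => ?_)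
  have h1 : 0 ≤ 1 - t := sub_nonneg.mpr ht.2.le
  set G' : ℝ → (ℕ → ℝ) → ℝ≥0∞ := fun z x =>
    ENNReal.ofReal (1 - t) * G t ((1 - t) * z) ((1 - t) • x) with hG'
  have hm : Measurable fun q : ℝ × (ℕ → ℝ) => G t ((1 - t) * q.1) ((1 - t) • q.2) :=
    hG.comp (measurable_const.prodMk (Measurable.prodMk (by fun_prop) (by fun_prop)))
  have hs' : IsSymmetric G' := fun z hz x x' h =>
    congrArg (ENNReal.ofReal (1 - t) * ·) (hs t ht.1.le _ (mul_nonneg h1 hz) _ _ (h.smul h1))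
  have he : ∀ x, secondPick G t ((1 - t) • x) = sizeBiasedSum G' x := fun x => by
    refine tsum_congr fun i => ?_
    rw [Pi.smul_apply, smul_eq_mul, ENNReal.ofReal_mul h1, ← smul_update_zero]
    simp only [hG']
    ring
  simp_rw [he]
  rw [lintegral_sizeBiasedSum hθ (hm.const_mul _) hs']
  refine lintegral_congr fun s => ?_
  simp only [hG']
  have hm' : Measurable fun x : ℕ → ℝ => G t ((1 - t) * s) ((1 - t - (1 - t) * s) • x) :=
    hG.comp (measurable_const.prodMk (measurable_const.prodMk (by fun_prop)))
  rw [← lintegral_const_mul _ hm']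
  refine lintegral_congr fun x => ?_
  rw [smul_smul, show (1 - t) * (1 - s) = 1 - t - (1 - t) * s by ring]

end SizeBias

/-! ### The Poisson–Dirichlet law through the unsorted sequence -/

/-- A function on `Δ₁`, regarded as a function of unsorted sequences. The truncation at `1` does
not affect sequences of nonnegative numbers with sum `1`; it makes the function depend only on the
collection of parts for all summable sequences. -/
noncomputable def unsorted (f : Delta1 → ℝ≥0∞) (x : ℕ → ℝ) : ℝ≥0∞ :=
  Function.extend Subtype.val f 0 (decRearr fun i => min (x i) 1)

theorem measurable_unsorted {f : Delta1 → ℝ≥0∞} (hf : Measurable f) : Measurable (unsorted f) := by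
  refine ((MeasurableEmbedding.subtype_coe measurableSet_Delta1).measurable_extend hf
    measurable_zero).comp (measurable_decRearr.comp ?_)
  exact measurable_pi_lambda _ fun i => (measurable_pi_apply i).min measurable_const

theorem SameParts.decRearr_min_eq {x x' : ℕ → ℝ} (h : SameParts x x') :
    (decRearr fun i => min (x i) 1) = decRearr fun i => min (x' i) 1 := by
  funext n
  refine eq_of_forall_lt_iff fun t => ?_
  rw [lt_decRearr_iff fun i => min_le_right _ _, lt_decRearr_iff fun i => min_le_right _ _]
  rcases lt_or_ge t 0 with ht | ht
  · have e : ∀ y : ℕ → ℝ, (∀ i, 0 ≤ y i) → {i | t < min (y i) 1} = Set.univ := fun y hy =>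
      Set.eq_univ_of_forall fun i => ht.trans_le (le_min (hy i) zero_le_one)
    rw [e x h.1, e x' h.2]
  · rcases lt_or_ge t 1 with ht1 | ht1
    · simp only [lt_min_iff, ht1, and_true]
      rw [h.5 t ht]
    · simp [ht1.not_gt]

theorem SameParts.unsorted_eq {x x' : ℕ → ℝ} (h : SameParts x x') (f : Delta1 → ℝ≥0∞) :
    unsorted f x = unsorted f x' := by
  rw [unsorted, h.decRearr_min_eq, ← unsorted]

theorem unsorted_of_hasSum (f : Delta1 → ℝ≥0∞) {x : ℕ → ℝ} (h0 : ∀ i, 0 ≤ x i)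
    (h1 : HasSum x 1) : unsorted f x = f ⟨decRearr x, decRearr_mem h0 h1⟩ := by
  have e : (fun i => min (x i) 1) = x := funext fun i => min_eq_left (le_one_of_hasSum h0 h1 i)
  rw [unsorted, e]
  exact Subtype.val_injective.extend_apply f 0 ⟨decRearr x, decRearr_mem h0 h1⟩

theorem lintegral_poissonDirichlet {θ : ℝ} (hθ : 0 < θ) {f : Delta1 → ℝ≥0∞} (hf : Measurable f) :
    ∫⁻ p, f p ∂poissonDirichlet θ = ∫⁻ x, unsorted f x ∂stickLaw (betaMeasure 1 θ) := by
  have := isProbabilityMeasureBeta one_pos hθ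
  have hae := ae_stickLaw_hasSum (ae_betaMeasure_mem_Ioo 1 θ)
  have hemb := MeasurableEmbedding.subtype_coe measurableSet_Delta1
  have hext : Measurable (Function.extend (Subtype.val : Delta1 → ℕ → ℝ) f 0) :=
    hemb.measurable_extend hf measurable_zero
  have hmap : (Measure.infinitePi fun _ : ℕ => betaMeasure 1 θ).map
      (fun t => decRearr (stickBreaking t)) = (stickLaw (betaMeasure 1 θ)).map decRearr := by
    rw [stickLaw, Measure.map_map measurable_decRearr measurable_stickBreaking]
    rfl
  have hmem : ∀ᵐ x ∂(stickLaw (betaMeasure 1 θ)).map decRearr, x ∈ Delta1 := by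
    refine (ae_map_iff (p := (· ∈ Delta1)) measurable_decRearr.aemeasurable
      measurableSet_Delta1).mpr ?_
    exact hae.mono fun x hx => decRearr_mem hx.1 hx.2
  calc ∫⁻ p, f p ∂poissonDirichlet θ
      = ∫⁻ p, Function.extend (Subtype.val : Delta1 → ℕ → ℝ) f 0 p ∂poissonDirichlet θ := by
        simp_rw [Subtype.val_injective.extend_apply]
    _ = ∫⁻ x, Function.extend (Subtype.val : Delta1 → ℕ → ℝ) f 0 x
          ∂(stickLaw (betaMeasure 1 θ)).map decRearr := by
        rw [← hemb.lintegral_map, poissonDirichlet, hmap, hemb.map_comap, Subtype.range_coe,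
          Measure.restrict_eq_self_of_ae_mem hmem]
    _ = ∫⁻ x, unsorted f x ∂stickLaw (betaMeasure 1 θ) := by
        rw [lintegral_map hext measurable_decRearr]
        refine lintegral_congr_ae (hae.mono fun x hx => ?_)
        simp only
        rw [unsorted_of_hasSum f hx.1 hx.2]
        exact Subtype.val_injective.extend_apply f 0 ⟨decRearr x, decRearr_mem hx.1 hx.2⟩

theorem isProbabilityMeasure_poissonDirichlet {θ : ℝ} (hθ : 0 < θ) :
    IsProbabilityMeasure (poissonDirichlet θ) := by
  have := isProbabilityMeasureBeta one_pos hθ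
  refine ⟨?_⟩
  rw [← lintegral_one, lintegral_poissonDirichlet hθ measurable_const]
  calc _ = ∫⁻ _, 1 ∂stickLaw (betaMeasure 1 θ) := lintegral_congr_ae
        ((ae_stickLaw_hasSum (ae_betaMeasure_mem_Ioo 1 θ)).mono fun x hx =>
          unsorted_of_hasSum _ hx.1 hx.2)
    _ = 1 := by simp

/-! ### Splits and merges as size-biased picks -/

/-- The contribution of the uniform split of a part of size `y`, divided by `y`, when the other
parts are those of `x`. -/
noncomputable def splitPick (h : (ℕ → ℝ) → ℝ≥0∞) (y : ℝ) (x : ℕ → ℝ) : ℝ≥0∞ :=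
  ENNReal.ofReal y * ∫⁻ u : unitInterval, h (cons (u * y) (cons ((1 - u) * y) x))

/-- The contribution of picking the part `y` twice, divided by `y`, without a move. -/
noncomputable def samePick (h : (ℕ → ℝ) → ℝ≥0∞) (y : ℝ) (x : ℕ → ℝ) : ℝ≥0∞ :=
  ENNReal.ofReal y * h (cons y x)

/-- The contribution of the merge of two picked parts `y` and `z`. -/
def mergePick (h : (ℕ → ℝ) → ℝ≥0∞) (y z : ℝ) (x : ℕ → ℝ) : ℝ≥0∞ :=
  h (cons (y + z) x)

/-- The contribution of picking the two parts `y` and `z` without a move. -/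
def distinctPick (h : (ℕ → ℝ) → ℝ≥0∞) (y z : ℝ) (x : ℕ → ℝ) : ℝ≥0∞ :=
  h (cons y (cons z x))

section Picks

variable {h : (ℕ → ℝ) → ℝ≥0∞}

theorem measurable_split_integrand (hm : Measurable h) :
    Measurable fun r : (ℝ × (ℕ → ℝ)) × unitInterval =>
      h (cons (r.2 * r.1.1) (cons ((1 - r.2) * r.1.1) r.1.2)) :=
  hm.comp (measurable_comp₂ measurable_cons (by fun_prop)
    (measurable_comp₂ measurable_cons (by fun_prop) (by fun_prop)))

theorem measurable_splitPick (hm : Measurable h) :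
    Measurable fun q : ℝ × (ℕ → ℝ) => splitPick h q.1 q.2 :=
  measurable_fst.ennreal_ofReal.mul (measurable_split_integrand hm).lintegral_prod_right'

theorem measurable_samePick (hm : Measurable h) :
    Measurable fun q : ℝ × (ℕ → ℝ) => samePick h q.1 q.2 :=
  measurable_fst.ennreal_ofReal.mul (hm.comp measurable_cons)

theorem measurable_mergePick (hm : Measurable h) :
    Measurable fun q : ℝ × ℝ × (ℕ → ℝ) => mergePick h q.1 q.2.1 q.2.2 :=
  hm.comp (measurable_comp₂ measurable_cons (by fun_prop) (by fun_prop))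

theorem measurable_distinctPick (hm : Measurable h) :
    Measurable fun q : ℝ × ℝ × (ℕ → ℝ) => distinctPick h q.1 q.2.1 q.2.2 :=
  hm.comp (measurable_comp₂ measurable_cons (by fun_prop)
    (measurable_comp₂ measurable_cons (by fun_prop) (by fun_prop)))

theorem isSymmetric_splitPick (hh : ∀ x x', SameParts x x' → h x = h x') :
    IsSymmetric (splitPick h) := by
  intro y hy x x' hx
  refine congrArg (ENNReal.ofReal y * ·) (lintegral_congr fun u => hh _ _ ?_)
  exact (hx.cons (mul_nonneg (sub_nonneg.mpr u.2.2) hy)).cons (mul_nonneg u.2.1 hy)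

theorem isSymmetric_samePick (hh : ∀ x x', SameParts x x' → h x = h x') :
    IsSymmetric (samePick h) :=
  fun y hy _ _ hx => congrArg (ENNReal.ofReal y * ·) (hh _ _ (hx.cons hy))

theorem isSymmetric_mergePick (hh : ∀ x x', SameParts x x' → h x = h x') (y : ℝ) (hy : 0 ≤ y) :
    IsSymmetric (mergePick h y) :=
  fun _ hz _ _ hx => hh _ _ (hx.cons (add_nonneg hy hz))

theorem isSymmetric_distinctPick (hh : ∀ x x', SameParts x x' → h x = h x') (y : ℝ)
    (hy : 0 ≤ y) : IsSymmetric (distinctPick h y) :=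
  fun _ hz _ _ hx => hh _ _ ((hx.cons hz).cons hy)

/-- A uniform split of a part picked twice turns the law of a part into the law of a pair of
parts. -/
theorem lintegral_splitPick {θ : ℝ} (hθ : 0 < θ) (hm : Measurable h)
    (hh : ∀ x x', SameParts x x' → h x = h x') :
    ENNReal.ofReal θ * ∫⁻ x, sizeBiasedSum (splitPick h) x ∂stickLaw (betaMeasure 1 θ) =
      ∫⁻ x, sizeBiasedSum (secondPick (distinctPick h)) x ∂stickLaw (betaMeasure 1 θ) := by
  have := isProbabilityMeasureBeta one_pos hθ
  set H : ℝ → ℝ → ℝ≥0∞ := fun y z => ∫⁻ x, h (cons y (cons z ((1 - y - z) • x)))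
    ∂stickLaw (betaMeasure 1 θ) with hH
  have hHm : Measurable fun q : ℝ × ℝ => H q.1 q.2 := by
    refine Measurable.lintegral_prod_right' (f := fun r : (ℝ × ℝ) × (ℕ → ℝ) =>
      h (cons r.1.1 (cons r.1.2 ((1 - r.1.1 - r.1.2) • r.2)))) ?_
    exact hm.comp (measurable_comp₂ measurable_cons (by fun_prop)
      (measurable_comp₂ measurable_cons (by fun_prop) (by fun_prop)))
  rw [lintegral_sizeBiasedSum_secondPick hθ (measurable_distinctPick hm)
    (isSymmetric_distinctPick hh), lintegral_sizeBiasedSum hθ (measurable_splitPick hm)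
    (isSymmetric_splitPick hh)]
  refine Eq.trans ?_ (lintegral_first_split hθ hHm)
  congr 1
  refine lintegral_congr fun t => ?_
  have hmt : Measurable fun r : (ℕ → ℝ) × unitInterval =>
      h (cons (r.2 * t) (cons ((1 - r.2) * t) ((1 - t) • r.1))) :=
    hm.comp (measurable_comp₂ measurable_cons (by fun_prop)
      (measurable_comp₂ measurable_cons (by fun_prop) (by fun_prop)))
  simp only [splitPick]
  rw [lintegral_const_mul _ hmt.lintegral_prod_right', lintegral_lintegral_swap hmt.aemeasurable]
  congr 1
  refine lintegral_congr fun u => lintegral_congr fun x => ?_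
  rw [show 1 - (u : ℝ) * t - (1 - u) * t = 1 - t by ring]

/-- Merging a picked pair of parts turns the law of a pair of parts into the law of a part picked
twice. -/
theorem lintegral_mergePick {θ : ℝ} (hθ : 0 < θ) (hm : Measurable h)
    (hh : ∀ x x', SameParts x x' → h x = h x') :
    ∫⁻ x, sizeBiasedSum (secondPick (mergePick h)) x ∂stickLaw (betaMeasure 1 θ) =
      ENNReal.ofReal θ * ∫⁻ x, sizeBiasedSum (samePick h) x ∂stickLaw (betaMeasure 1 θ) := by
  have := isProbabilityMeasureBeta one_pos hθ
  set H : ℝ → ℝ → ℝ≥0∞ := fun y z => ∫⁻ x, h (cons (y + z) ((1 - y - z) • x))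
    ∂stickLaw (betaMeasure 1 θ) with hH
  have hHm : Measurable fun q : ℝ × ℝ => H q.1 q.2 := by
    refine Measurable.lintegral_prod_right' (f := fun r : (ℝ × ℝ) × (ℕ → ℝ) =>
      h (cons (r.1.1 + r.1.2) ((1 - r.1.1 - r.1.2) • r.2))) ?_
    exact hm.comp (measurable_comp₂ measurable_cons (by fun_prop) (by fun_prop))
  rw [lintegral_sizeBiasedSum_secondPick hθ (measurable_mergePick hm)
    (isSymmetric_mergePick hh), lintegral_sizeBiasedSum hθ (measurable_samePick hm)
    (isSymmetric_samePick hh)]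
  refine (lintegral_first_split hθ hHm).symm.trans ?_
  congr 1
  refine lintegral_congr fun t => ?_
  have hmt : Measurable fun x : ℕ → ℝ => h (cons t ((1 - t) • x)) :=
    hm.comp (measurable_comp₂ measurable_cons (by fun_prop) (by fun_prop))
  simp only [samePick]
  rw [lintegral_const_mul _ hmt]
  congr 1
  -- the merge of the two parts of a split does not depend on the splitting point
  have hu : ∀ u : unitInterval, H (u * t) ((1 - u) * t) =
      ∫⁻ x, h (cons t ((1 - t) • x)) ∂stickLaw (betaMeasure 1 θ) := fun u => by
    simp only [hH]
    rw [show (u : ℝ) * t + (1 - u) * t = t by ring,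
      show 1 - (u : ℝ) * t - (1 - u) * t = 1 - t by ring]
  simp_rw [hu]
  simp

/-- The terms with equal indices drop out because the picked entry has been replaced by `0`. -/
theorem sizeBiasedSum_secondPick (G : ℝ → ℝ → (ℕ → ℝ) → ℝ≥0∞) {x : ℕ → ℝ} (h0 : ∀ i, 0 ≤ x i) :
    sizeBiasedSum (secondPick G) x = ∑' ij : {ij : ℕ × ℕ // ij.1 ≠ ij.2},
      ENNReal.ofReal (x ij.1.1 * x ij.1.2) *
        G (x ij.1.1) (x ij.1.2) (Function.update (Function.update x ij.1.1 0) ij.1.2 0) := by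
  set g : ℕ × ℕ → ℝ≥0∞ := fun ij => ENNReal.ofReal (x ij.1) *
    (ENNReal.ofReal (Function.update x ij.1 0 ij.2) * G (x ij.1) (Function.update x ij.1 0 ij.2)
      (Function.update (Function.update x ij.1 0) ij.2 0)) with hg
  have h1 : sizeBiasedSum (secondPick G) x = ∑' ij, g ij := by
    rw [ENNReal.tsum_prod']
    refine tsum_congr fun i => ?_
    simp only [hg]
    rw [ENNReal.tsum_mul_left]
    rfl
  rw [h1, ← tsum_subtype_eq_of_support_subset (s := {ij : ℕ × ℕ | ij.1 ≠ ij.2}) (f := g)]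
  · refine tsum_congr fun ij => ?_
    simp only [hg]
    rw [Function.update_of_ne (Ne.symm ij.2), ENNReal.ofReal_mul (h0 _), mul_assoc]
  · rintro ⟨i, j⟩ hij (rfl : i = j)
    exact hij (by simp [hg])

end Picks

/-! ### The kernel -/

section Kernel

variable {f : Delta1 → ℝ≥0∞} {x : ℕ → ℝ}

theorem sizeBiasedSum_splitPick (f : Delta1 → ℝ≥0∞) (p : Delta1) :
    sizeBiasedSum (splitPick (unsorted f)) p.1 = ∑' i, ENNReal.ofReal (p.1 i ^ 2) *
      ∫⁻ u : unitInterval, f (split i u p) := by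
  refine tsum_congr fun i => ?_
  have h0 : ∀ k, 0 ≤ p.1 k := fun k => (p.2.1 k).1
  rw [splitPick, ← mul_assoc, ← ENNReal.ofReal_mul (h0 i), sq]
  congr 1
  refine lintegral_congr fun u => ?_
  have h1 : 0 ≤ (1 - (u : ℝ)) * p.1 i := mul_nonneg (sub_nonneg.mpr u.2.2) (h0 i)
  have hupd := sameParts_cons_update (x := Function.update p.1 i ((1 - (u : ℝ)) * p.1 i))
    (fun k => by
      rw [Function.update_apply]
      split_ifs
      exacts [h1, h0 k]) (p.2.2.2.summable.update i _) i
  rw [Function.update_self, Function.update_idem] at hupd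
  have hsplit : splitSeq i u p.1 =
      cons (u * p.1 i) (Function.update p.1 i ((1 - (u : ℝ)) * p.1 i)) := by
    funext k
    cases k <;> rfl
  rw [← (hupd.cons (mul_nonneg u.2.1 (h0 i))).unsorted_eq, ← hsplit,
    unsorted_of_hasSum f (splitSeq_nonneg i u p) (splitSeq_hasSum i u p)]
  rfl

theorem sizeBiasedSum_mergePick (f : Delta1 → ℝ≥0∞) (p : Delta1) :
    sizeBiasedSum (secondPick (mergePick (unsorted f))) p.1 =
      ∑' ij : {ij : ℕ × ℕ // ij.1 ≠ ij.2},
        ENNReal.ofReal (p.1 ij.1.1 * p.1 ij.1.2) * f (merge ij p) := by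
  have h0 : ∀ k, 0 ≤ p.1 k := fun k => (p.2.1 k).1
  rw [sizeBiasedSum_secondPick _ h0]
  refine tsum_congr fun ij => ?_
  congr 1
  obtain ⟨⟨i, j⟩, hij⟩ := ij
  have hupd := sameParts_cons_update (mergeSeq_nonneg i j p) (mergeSeq_hasSum hij p).summable i
  have hi : mergeSeq i j p.1 i = p.1 i + p.1 j := Function.update_self ..
  have hrest : Function.update (mergeSeq i j p.1) i 0 =
      Function.update (Function.update p.1 i 0) j 0 := by
    rw [Function.update_comm hij, mergeSeq.eq_def, Function.update_idem]
  rw [hi, hrest] at hupd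
  simp only [mergePick]
  rw [← hupd.unsorted_eq, unsorted_of_hasSum f (mergeSeq_nonneg i j p) (mergeSeq_hasSum hij p)]
  rfl

theorem sizeBiasedSum_samePick {h : (ℕ → ℝ) → ℝ≥0∞} (hh : ∀ x x', SameParts x x' → h x = h x')
    (p : Delta1) :
    sizeBiasedSum (samePick h) p.1 = (∑' i, ENNReal.ofReal (p.1 i ^ 2)) * h p.1 := by
  have h0 : ∀ k, 0 ≤ p.1 k := fun k => (p.2.1 k).1
  rw [← ENNReal.tsum_mul_right]
  refine tsum_congr fun i => ?_
  rw [samePick, ← mul_assoc, ← ENNReal.ofReal_mul (h0 i), sq,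
    hh _ _ (sameParts_cons_update h0 p.2.2.2.summable i)]

theorem sizeBiasedSum_distinctPick {h : (ℕ → ℝ) → ℝ≥0∞}
    (hh : ∀ x x', SameParts x x' → h x = h x') (p : Delta1) :
    sizeBiasedSum (secondPick (distinctPick h)) p.1 =
      (∑' ij : {ij : ℕ × ℕ // ij.1 ≠ ij.2}, ENNReal.ofReal (p.1 ij.1.1 * p.1 ij.1.2)) * h p.1 := by
  have h0 : ∀ k, 0 ≤ p.1 k := fun k => (p.2.1 k).1
  rw [sizeBiasedSum_secondPick _ h0, ← ENNReal.tsum_mul_right]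
  refine tsum_congr fun ij => ?_
  have h1 := sameParts_cons_update h0 p.2.2.2.summable ij.1.1
  have h2 := sameParts_cons_update (update_zero_nonneg h0 ij.1.1)
    (p.2.2.2.summable.update ij.1.1 0) ij.1.2
  rw [Function.update_of_ne (Ne.symm ij.2)] at h2
  rw [hh _ _ (h1.trans (h2.cons (h0 _))), distinctPick]

theorem lintegral_splitMergeMeasure (βs βm : ℝ) (hf : Measurable f) (p : Delta1) :
    ∫⁻ q, f q ∂splitMergeMeasure βs βm p =
      ENNReal.ofReal βs * sizeBiasedSum (splitPick (unsorted f)) p.1 +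
      ENNReal.ofReal βm * sizeBiasedSum (secondPick (mergePick (unsorted f))) p.1 +
      ENNReal.ofReal (1 - βs * ∑' i, p.1 i ^ 2
        - βm * ∑' ij : {ij : ℕ × ℕ // ij.1 ≠ ij.2}, p.1 ij.1.1 * p.1 ij.1.2) * f p := by
  simp only [splitMergeMeasure, lintegral_add_measure, lintegral_smul_measure,
    lintegral_sum_measure, lintegral_dirac' _ hf, lintegral_map hf (measurable_split_left _ p),
    smul_eq_mul, sizeBiasedSum_splitPick, sizeBiasedSum_mergePick]

theorem splitMergeMeasure_weights {βs βm : ℝ} (hs : βs ∈ Set.Ioc (0 : ℝ) 1)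
    (hm : βm ∈ Set.Ioc (0 : ℝ) 1) (p : Delta1) :
    ENNReal.ofReal (1 - βs * ∑' i, p.1 i ^ 2
        - βm * ∑' ij : {ij : ℕ × ℕ // ij.1 ≠ ij.2}, p.1 ij.1.1 * p.1 ij.1.2) +
      (ENNReal.ofReal βs * ∑' i, ENNReal.ofReal (p.1 i ^ 2) +
      ENNReal.ofReal βm * ∑' ij : {ij : ℕ × ℕ // ij.1 ≠ ij.2},
        ENNReal.ofReal (p.1 ij.1.1 * p.1 ij.1.2)) = 1 := by
  have := isMarkovKernel_splitMergeKernel hs hm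
  have h1 : splitMergeMeasure βs βm p Set.univ = 1 :=
    measure_univ (μ := splitMergeKernel βs βm p)
  have hmap : ∀ i, (volume : Measure unitInterval).map (fun u => split i u p) Set.univ = 1 := by
    intro i
    rw [Measure.map_apply (measurable_split_left i p) MeasurableSet.univ, Set.preimage_univ,
      measure_univ]
  simp only [splitMergeMeasure, Measure.add_apply, Measure.smul_apply,
    Measure.sum_apply _ MeasurableSet.univ, smul_eq_mul, hmap, measure_univ, mul_one] at h1
  rw [add_comm]
  exact h1

/-- The mean of `f` after one step, plus the mass that is subject to a split or a merge, equals the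
mean of `f` over the splits and merges plus `f` itself. Stated with a sum rather than a difference,
since subtraction of extended nonnegative reals truncates. The second part bounds the added mass,
so that it can be cancelled after integration. -/
theorem lintegral_splitMergeMeasure_add {βs βm : ℝ} (hs : βs ∈ Set.Ioc (0 : ℝ) 1)
    (hm : βm ∈ Set.Ioc (0 : ℝ) 1) (hf : Measurable f) (h0 : ∀ i, 0 ≤ x i) (h1 : HasSum x 1) :
    unsorted (fun p => ∫⁻ q, f q ∂splitMergeMeasure βs βm p) x +
        (ENNReal.ofReal βs * sizeBiasedSum (samePick (unsorted f)) x +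
          ENNReal.ofReal βm * sizeBiasedSum (secondPick (distinctPick (unsorted f))) x) =
      ENNReal.ofReal βs * sizeBiasedSum (splitPick (unsorted f)) x +
        ENNReal.ofReal βm * sizeBiasedSum (secondPick (mergePick (unsorted f))) x +
        unsorted f x ∧
    ENNReal.ofReal βs * sizeBiasedSum (samePick (unsorted f)) x +
      ENNReal.ofReal βm * sizeBiasedSum (secondPick (distinctPick (unsorted f))) x ≤
        unsorted f x := by
  have hh : ∀ y y', SameParts y y' → unsorted f y = unsorted f y' := fun y y' h => h.unsorted_eq f
  have hsort := (sameParts_decRearr h0 h1).symm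
  set p : Delta1 := ⟨decRearr x, decRearr_mem h0 h1⟩ with hp
  have hfp : unsorted f p.1 = f p := by
    rw [← hsort.unsorted_eq f, unsorted_of_hasSum f h0 h1]
  rw [unsorted_of_hasSum _ h0 h1, sizeBiasedSum_eq_of_sameParts (isSymmetric_samePick hh) hsort,
    sizeBiasedSum_eq_of_sameParts (isSymmetric_splitPick hh) hsort,
    sizeBiasedSum_eq_of_sameParts (isSymmetric_secondPick (isSymmetric_distinctPick hh)) hsort,
    sizeBiasedSum_eq_of_sameParts (isSymmetric_secondPick (isSymmetric_mergePick hh)) hsort,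
    unsorted_of_hasSum f h0 h1, ← hp, lintegral_splitMergeMeasure βs βm hf p]
  change _ + (ENNReal.ofReal βs * sizeBiasedSum _ p.1 + ENNReal.ofReal βm * sizeBiasedSum _ p.1) =
    _ ∧ ENNReal.ofReal βs * sizeBiasedSum _ p.1 + ENNReal.ofReal βm * sizeBiasedSum _ p.1 ≤ _
  rw [sizeBiasedSum_samePick hh, sizeBiasedSum_distinctPick hh, hfp, ← mul_assoc, ← mul_assoc,
    ← add_mul]
  have hw := splitMergeMeasure_weights hs hm p
  constructor
  · rw [add_assoc _ _ (_ * f p), ← add_mul, hw, one_mul]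
  · calc _ ≤ 1 * f p := by
          gcongr
          exact hw ▸ le_add_self
      _ = f p := one_mul _

end Kernel

theorem invariant_poissonDirichlet {βs βm : ℝ} (hs : βs ∈ Set.Ioc (0 : ℝ) 1)
    (hm : βm ∈ Set.Ioc (0 : ℝ) 1) :
    (splitMergeKernel βs βm).Invariant (poissonDirichlet (βs / βm)) := by
  have hθ : 0 < βs / βm := div_pos hs.1 hm.1
  set θ := βs / βm with hθdef
  have := isProbabilityMeasureBeta one_pos hθ
  have hβ : ENNReal.ofReal βs = ENNReal.ofReal βm * ENNReal.ofReal θ := by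
    rw [← ENNReal.ofReal_mul hm.1.le, hθdef, mul_div_cancel₀ _ hm.1.ne']
  rw [Kernel.Invariant]
  ext A hA
  set f : Delta1 → ℝ≥0∞ := A.indicator 1 with hf
  have hfm : Measurable f := measurable_one.indicator hA
  have hh : ∀ y y', SameParts y y' → unsorted f y = unsorted f y' := fun y y' h => h.unsorted_eq f
  have hum := measurable_unsorted hfm
  have hae := ae_stickLaw_hasSum (ae_betaMeasure_mem_Ioo 1 θ)
  set ν := stickLaw (betaMeasure 1 θ) with hν
  have hgm : Measurable fun p => ∫⁻ q, f q ∂splitMergeMeasure βs βm p :=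
    (Measure.measurable_lintegral hfm).comp (measurable_splitMergeMeasure βs βm)
  have hsplit := measurable_sizeBiasedSum (measurable_splitPick hum)
  have hmerge := measurable_sizeBiasedSum (measurable_secondPick (measurable_mergePick hum))
  have hsame := measurable_sizeBiasedSum (measurable_samePick hum)
  have hdist := measurable_sizeBiasedSum (measurable_secondPick (measurable_distinctPick hum))
  have hlhs : (poissonDirichlet θ).bind (splitMergeKernel βs βm) A =
      ∫⁻ x, unsorted (fun p => ∫⁻ q, f q ∂splitMergeMeasure βs βm p) x ∂ν := by
    rw [Measure.bind_apply hA (Kernel.aemeasurable _), ← lintegral_poissonDirichlet hθ hgm]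
    refine lintegral_congr fun p => ?_
    rw [hf, lintegral_indicator_one hA]
    rfl
  have hrhs : poissonDirichlet θ A = ∫⁻ x, unsorted f x ∂ν := by
    rw [← lintegral_poissonDirichlet hθ hfm, hf, lintegral_indicator_one hA]
  have hfin : ENNReal.ofReal βs * ∫⁻ x, sizeBiasedSum (samePick (unsorted f)) x ∂ν +
      ENNReal.ofReal βm *
        ∫⁻ x, sizeBiasedSum (secondPick (distinctPick (unsorted f))) x ∂ν ≠ ⊤ := by
    rw [← lintegral_const_mul _ hsame, ← lintegral_const_mul _ hdist,
      ← lintegral_add_left (hsame.const_mul _)]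
    have hle := lintegral_mono_ae (hae.mono fun x hx =>
      (lintegral_splitMergeMeasure_add hs hm hfm hx.1 hx.2).2)
    rw [← hrhs] at hle
    have := isProbabilityMeasure_poissonDirichlet hθ
    exact ne_top_of_le_ne_top (measure_ne_top _ _) hle
  have hbal := lintegral_congr_ae (hae.mono fun x hx =>
    (lintegral_splitMergeMeasure_add hs hm hfm hx.1 hx.2).1)
  rw [lintegral_add_left (measurable_unsorted hgm), lintegral_add_left (hsame.const_mul _),
    lintegral_add_right _ hum, lintegral_add_left (hsplit.const_mul _),
    lintegral_const_mul _ hsame, lintegral_const_mul _ hdist, lintegral_const_mul _ hsplit,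
    lintegral_const_mul _ hmerge, lintegral_mergePick hθ hum hh] at hbal
  -- splits balance the pairs of distinct parts, merges balance the parts picked twice
  have hs1 : ENNReal.ofReal βs * ∫⁻ x, sizeBiasedSum (splitPick (unsorted f)) x ∂ν =
      ENNReal.ofReal βm * ∫⁻ x, sizeBiasedSum (secondPick (distinctPick (unsorted f))) x ∂ν := by
    rw [hβ, mul_assoc, lintegral_splitPick hθ hum hh]
  rw [hs1, ← mul_assoc, ← hβ, add_comm (ENNReal.ofReal βm * _), add_comm _ (lintegral ν _)] at hbal
  rw [hlhs, hrhs]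
  exact (ENNReal.add_left_inj hfin).mp hbal

end SplitMerge

/-- The Poisson–Dirichlet law with parameter `βs / βm` is a probability measure on `Δ₁` and is
invariant for the uniform `(βs, βm)` split–merge chain. -/
theorem mainTheorem2 (βs βm : ℝ) (hs : βs ∈ Set.Ioc (0 : ℝ) 1) (hm : βm ∈ Set.Ioc (0 : ℝ) 1) :
    MeasureTheory.IsProbabilityMeasure (SplitMerge.poissonDirichlet (βs / βm)) ∧
      (SplitMerge.splitMergeKernel βs βm).Invariant (SplitMerge.poissonDirichlet (βs / βm)) :=
  ⟨SplitMerge.isProbabilityMeasure_poissonDirichlet (div_pos hs.1 hm.1),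
    SplitMerge.invariant_poissonDirichlet hs hm⟩
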